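/- **Setting.** Let $E$ be a finite-dimensional real (Euclidean) or complex (Hermitian) inner product space and let $\sigma=(E_1,\dots,E_s)$ be an orthogonal splitting of $E$, that is, a finite sequence of pairwise orthogonal linear subspaces of positive dimension with $E=E_1\oplus\dots\oplus E_s$. A linear subspace $Q\subseteq E$ is *adapted* to $\sigma$ if $Q=(Q\cap E_1)\oplus\dots\oplus(Q\cap E_s)$; the set of adapted subspaces is denoted by $\mathsf{Gr}(E,\sigma)$. It carries the usual topology of Grassmannians (the one induced by $Q\mapsto\Pi_Q$, where $\Pi_Q$ is the orthogonal projection of $E$ onto $Q$) and its Borel $\sigma$-algebra. An adapted subspace $Q$ is itself split by $\sigma_Q=(Q\cap E_1,\dots,Q\cap E_s)$ (where zero subspaces are allowed), and $\mathsf{Gr}(Q,\sigma_Q)$ is seen as a subset of $\mathsf{Gr}(E,\sigma)$. For a finite-dimensional inner product space $F$ and $0\le n\le\dim F$, let $\nu^F_n$ be the unique Borel measure of total mass $\binom{\dim F}{n}$ on the Grassmannian of $n$-dimensional subspaces of $F$ that is invariant under all linear isometries of $F$. For $Q\in\mathsf{Gr}(E,\sigma)$, let $$\nu^{Q,\sigma_Q}=\sum_{n_1=0}^{\dim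 (Q\cap E_1)}\cdots\sum_{n_s=0}^{\dim (Q\cap E_s)}\nu^{Q\cap E_1}_{n_1}\otimes\dots\otimes\nu^{Q\cap E_s}_{n_s},$$ seen as a measure on $\mathsf{Gr}(E,\sigma)$ through $(Q_1,\dots,Q_s)\mapsto Q_1\oplus\dots\oplus Q_s$; for $Q=E$ it is denoted by $\nu^{E,\sigma}$. The *incidence measure* of a Borel measure $\mu$ on $\mathsf{Gr}(E,\sigma)$ is $$Z\mu=\int_{\mathsf{Gr}(E,\sigma)}\nu^{Q,\sigma_Q}\,d\mu(Q).$$ For a linear endomorphism $k$ of $E$ and a subspace $Q$ of $E$, let $k^Q_Q:Q\to Q$ be the inclusion $Q\to E$ followed by $k$ and by the orthogonal projection $E\to Q$. A Borel probability measure $\mu$ on $\mathsf{Gr}(E,\sigma)$ is a *determinantal linear process on $(E,\sigma)$ with kernel $k$* if $Z\mu$ is absolutely continuous with respect to $\nu^{E,\sigma}$ with density $Q\mapsto\det k^Q_Q$. **Theorem.** Let $k$ be a self-adjoint endomorphism of $E$ with $0\le k\le 1$. 1. There exists a unique determinantal linear process $\mu_{\sigma,k}$ on $(E,\sigma)$ with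 kernel $k$. 2. For every $Q\in\mathsf{Gr}(E,\sigma)$, the number $\det\big(k\,\Pi_Q+(1-k)\,\Pi_{Q^\perp}\big)$ is real and non-negative, and $$d\mu(Q)=\det\big(k\,\Pi_Q+(1-k)\,\Pi_{Q^\perp}\big)\,d\nu^{E,\sigma}(Q)$$ defines a probability measure on $\mathsf{Gr}(E,\sigma)$ which is a determinantal linear process on $(E,\sigma)$ with kernel $k$; hence $\mu=\mu_{\sigma,k}$. -/

import Mathlib

open MeasureTheory
open scoped NNReal ENNReal

namespace DLP

noncomputable section

section Grassmannian

variable (𝕜 : Type*) [RCLike 𝕜] (F : Type*) [NormedAddCommGroup F] [InnerProductSpace 𝕜 F]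

/-- The set of all linear subspaces of a finite-dimensional inner product space, that is, the full
Grassmannian, carries the topology of the orthogonal projections: a subspace `Q` is identified with
the orthogonal projection `Π_Q`, and the topology is the one inherited from the endomorphisms. -/
instance instTopologicalSpaceSubmodule [FiniteDimensional 𝕜 F] :
    TopologicalSpace (Submodule 𝕜 F) :=
  TopologicalSpace.induced (fun Q : Submodule 𝕜 F => (Q.starProjection : F →L[𝕜] F)) inferInstance

/-- The Borel σ-algebra of the Grassmannian. -/
instance instMeasurableSpaceSubmodule [FiniteDimensional 𝕜 F] :
    MeasurableSpace (Submodule 𝕜 F) :=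
  borel _

instance instBorelSpaceSubmodule [FiniteDimensional 𝕜 F] : BorelSpace (Submodule 𝕜 F) := ⟨rfl⟩

/-- The group `U(F)` of isometries of `F` (orthogonal or unitary) is compact. -/
instance instCompactSpaceUnitary [FiniteDimensional 𝕜 F] [CompleteSpace F] :
    CompactSpace (unitary (F →L[𝕜] F)) := by
  have : ProperSpace (F →L[𝕜] F) := FiniteDimensional.proper 𝕜 (F →L[𝕜] F)
  refine isCompact_iff_compactSpace (s := (unitary (F →L[𝕜] F) : Set (F →L[𝕜] F))).1 ?_
  refine Metric.isCompact_of_isClosed_isBounded isClosed_unitary ?_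
  refine (Metric.isBounded_closedBall (x := (0 : F →L[𝕜] F)) (r := 1)).subset ?_
  intro u hu
  rw [mem_closedBall_zero_iff]
  refine ContinuousLinearMap.opNorm_le_bound _ zero_le_one fun x => ?_
  rw [one_mul, ContinuousLinearMap.norm_map_of_mem_unitary hu]

/-- The normalised Haar measure on the compact group `U(F)`. -/
def unitaryHaar [FiniteDimensional 𝕜 F] [CompleteSpace F] :
    Measure (unitary (F →L[𝕜] F)) :=
  Measure.haarMeasure ⊤

/-- The measure `ν_n^F`: the `U(F)`-invariant Borel measure with total mass `(dim F).choose n` on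
the Grassmannian of `n`-dimensional subspaces of `F`, seen as a measure on the full Grassmannian.
It is obtained by averaging over `u ∈ U(F)` the sum of the Dirac masses at the subspaces
`u (Vect (e_j : j ∈ J))` with `|J| = n`, where `(e_j)` is an orthonormal basis of `F`. -/
def grassmannMeasure [FiniteDimensional 𝕜 F] (n : ℕ) : Measure (Submodule 𝕜 F) :=
  haveI : CompleteSpace F := FiniteDimensional.complete 𝕜 F
  ∑ J ∈ (Finset.univ : Finset (Fin (Module.finrank 𝕜 F))).powersetCard n,
    (unitaryHaar 𝕜 F).map fun u : unitary (F →L[𝕜] F) =>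
      (Submodule.span 𝕜 (stdOrthonormalBasis 𝕜 F '' (J : Set (Fin (Module.finrank 𝕜 F))))).map
        ((u : F →L[𝕜] F) : F →ₗ[𝕜] F)

end Grassmannian

/-- An orthogonal splitting of an inner product space `E`: a finite sequence of pairwise orthogonal
subspaces of positive dimension, the sum of which is `E`. -/
structure Splitting (𝕜 : Type*) [RCLike 𝕜] (E : Type*) [NormedAddCommGroup E]
    [InnerProductSpace 𝕜 E] where
  /-- the number of subspaces -/
  s : ℕ
  /-- the subspaces `E_1, …, E_s` -/
  V : Fin s → Submodule 𝕜 E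
  finrank_pos : ∀ i, 0 < Module.finrank 𝕜 (V i)
  orthogonal : ∀ i j, i ≠ j → V i ⟂ V j
  iSup_eq_top : ⨆ i, V i = ⊤

namespace Splitting

variable {𝕜 : Type*} [RCLike 𝕜] {E : Type*} [NormedAddCommGroup E] [InnerProductSpace 𝕜 E]

/-- `Q` is adapted to `σ = (E_1, …, E_s)` if `Q = (Q ∩ E_1) ⊕ … ⊕ (Q ∩ E_s)`. The sum is
automatically direct since the `E_i` are pairwise orthogonal. -/
def IsAdapted (σ : Splitting 𝕜 E) (Q : Submodule 𝕜 E) : Prop :=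
  Q = ⨆ i, Q ⊓ σ.V i

theorem isAdapted_iSup (σ : Splitting 𝕜 E) (R : Fin σ.s → Submodule 𝕜 E)
    (hR : ∀ i, R i ≤ σ.V i) : σ.IsAdapted (⨆ i, R i) :=
  le_antisymm (iSup_le fun i => le_iSup_of_le i (le_inf (le_iSup R i) (hR i)))
    (iSup_le fun _ => inf_le_left)

/-- The split Grassmannian `Gr(E, σ)`, with the topology and the Borel σ-algebra induced by those
of the Grassmannian of `E`. -/
abbrev Gr (σ : Splitting 𝕜 E) : Type _ := {Q : Submodule 𝕜 E // σ.IsAdapted Q}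

/-- The direct sum `Q_1 ⊕ … ⊕ Q_s`, as an element of `Gr(E, σ)`, of subspaces `Q_i` of `W_i`, where
`W_i` is a subspace of `E_i`. -/
def directSum (σ : Splitting 𝕜 E) (W : Fin σ.s → Submodule 𝕜 E) (hW : ∀ i, W i ≤ σ.V i)
    (Q : ∀ i, Submodule 𝕜 (W i)) : σ.Gr :=
  ⟨⨆ i, (Q i).map (W i).subtype,
    σ.isAdapted_iSup _ fun i => (Submodule.map_subtype_le (W i) (Q i)).trans (hW i)⟩

variable [FiniteDimensional 𝕜 E]

/-- Given subspaces `W_i ≤ E_i`, the uniform measure `ν^{W, (W_1, …, W_s)}` on the split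
Grassmannian of `W = W_1 ⊕ … ⊕ W_s` (a subset of `Gr(E, σ)`): the sum over all split dimensions
`n = (n_1, …, n_s)` with `n_i ≤ dim W_i` of the images of the product measures
`ν_{n_1}^{W_1} ⊗ … ⊗ ν_{n_s}^{W_s}` by `(Q_1, …, Q_s) ↦ Q_1 ⊕ … ⊕ Q_s`. -/
def splitMeasure (σ : Splitting 𝕜 E) (W : Fin σ.s → Submodule 𝕜 E) (hW : ∀ i, W i ≤ σ.V i) :
    Measure σ.Gr :=
  ∑ n ∈ Fintype.piFinset fun i => Finset.range (Module.finrank 𝕜 (W i) + 1),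
    (Measure.pi fun i => grassmannMeasure 𝕜 (W i) (n i)).map (σ.directSum W hW)

/-- The reference measure `ν^{E, σ}` on `Gr(E, σ)`. -/
def nu (σ : Splitting 𝕜 E) : Measure σ.Gr :=
  σ.splitMeasure σ.V fun _ => le_rfl

/-- For `Q` in `Gr(E, σ)`, the measure `ν^{Q, σ_Q}` on the split Grassmannian of `Q` with its
induced splitting `σ_Q = (Q ∩ E_1, …, Q ∩ E_s)`, seen as a measure on `Gr(E, σ)`. -/
def nuSub (σ : Splitting 𝕜 E) (Q : σ.Gr) : Measure σ.Gr :=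
  σ.splitMeasure (fun i => Q.1 ⊓ σ.V i) fun _ => inf_le_right

/-- The incidence measure `∫ ν^{Q, σ_Q} dμ(Q)` of a measure `μ` on `Gr(E, σ)`. -/
def incidence (σ : Splitting 𝕜 E) (μ : Measure σ.Gr) : Measure σ.Gr :=
  μ.bind σ.nuSub

end Splitting

variable {𝕜 : Type*} [RCLike 𝕜] {E : Type*} [NormedAddCommGroup E] [InnerProductSpace 𝕜 E]
  [FiniteDimensional 𝕜 E]

/-- The compression `k_Q^Q : Q → Q` of an endomorphism `k`: the inclusion of `Q` in `E`, followed
by `k`, followed by the orthogonal projection on `Q`. -/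
def compression (k : E →ₗ[𝕜] E) (Q : Submodule 𝕜 E) : Q →ₗ[𝕜] Q :=
  (Q.orthogonalProjectionOnto : E →ₗ[𝕜] Q) ∘ₗ k ∘ₗ Q.subtype

/-- `μ` is a determinantal linear process on `(E, σ)` with kernel `k`: it is a Borel probability
measure on `Gr(E, σ)` whose incidence measure has the density `Q ↦ det k_Q^Q` with respect to
`ν^{E, σ}` (in particular, these determinants are non-negative real numbers). -/
structure IsDLP (σ : Splitting 𝕜 E) (k : E →ₗ[𝕜] E) (μ : Measure σ.Gr) : Prop where
  isProbabilityMeasure : IsProbabilityMeasure μ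
  density : ∃ f : σ.Gr → ℝ≥0,
    (∀ Q : σ.Gr, ((f Q : ℝ) : 𝕜) = LinearMap.det (compression k Q.1)) ∧
    σ.incidence μ = σ.nu.withDensity fun Q => (f Q : ℝ≥0∞)

end

end DLP

namespace DLP

noncomputable section

/-! ### Borel structure of the Grassmannian and of the unitary group. -/

section Topology

variable {𝕜 : Type*} [RCLike 𝕜] {F : Type*} [NormedAddCommGroup F] [InnerProductSpace 𝕜 F]

/-! Fix an orthonormal basis of each E_i and rotate it by a Haar-distributed isometry u_i. For a
family J of index sets J_i, let `flat e J u` be the span of the rotated vectors indexed by J. Then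
ν^{E,σ} is the sum over all J of the laws of `flat e J u` (`splitMeasure_eq_sum`).

Multiplying u on the right by isometries that act only on the coordinates in J leaves `flat e J u`
unchanged and preserves Haar measure. This extra randomness is exactly what sampling from ν^{Q,σ_Q}
inside Q = `flat e J u` requires. So the joint measure ν^{Q,σ_Q}(dR) ν^{E,σ}(dQ) is the sum, over
pairs I ⊆ J, of the laws of (`flat e J u`, `flat e I u`). Consequently the incidence measure of
g·ν^{E,σ} has density Σ_{J ⊇ I} g(`flat e J u`) at `flat e I u` (`lintegral_mul_nuSub`).

For a fixed u, all these flats are coordinate subspaces of a single orthonormal basis of E. In that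
basis the columns of k Π_Q + (1-k) Π_{Q^⊥} are k c_j for j in J and c_j - k c_j otherwise, so
summing determinants over J ⊇ I replaces each column outside I by c_j, which leaves det k_Q^Q for
the flat of I (`sum_det_mixedOp`).

Non-negativity: k Π_Q + (1-k) Π_{Q^⊥} is conjugate to its adjoint by the reflection in Q, hence has
a real determinant, and it is accretive, hence is joined to the identity by operators that are
invertible except perhaps at its own end. The total mass is 1 because every ν^{Q,σ_Q} gives mass 1
to the zero subspace, where the incidence density is an empty determinant.

Uniqueness holds because the incidence map is triangular for the dimension: ν^{Q,σ_Q} restricted to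
subspaces of dimension dim Q is the Dirac mass at Q, and a finite measure is recovered from the top
dimension downwards (`eq_of_incidence_eq`). -/

theorem secondCountableTopology_clm [FiniteDimensional 𝕜 F] :
    SecondCountableTopology (F →L[𝕜] F) := by
  have : ProperSpace (F →L[𝕜] F) := FiniteDimensional.proper 𝕜 (F →L[𝕜] F)
  infer_instance

theorem continuous_starProjection [FiniteDimensional 𝕜 F] :
    Continuous fun Q : Submodule 𝕜 F => (Q.starProjection : F →L[𝕜] F) :=
  continuous_induced_dom

theorem starProjection_injective [FiniteDimensional 𝕜 F] :
    Function.Injective fun Q : Submodule 𝕜 F => (Q.starProjection : F →L[𝕜] F) :=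
  fun Q R h => by
    have h' : Q.starProjection = R.starProjection := h
    rw [← Submodule.range_starProjection Q, h', Submodule.range_starProjection]

instance [FiniteDimensional 𝕜 F] : SecondCountableTopology (Submodule 𝕜 F) := by
  have := secondCountableTopology_clm (𝕜 := 𝕜) (F := F)
  exact TopologicalSpace.secondCountableTopology_induced _ _ _

instance [FiniteDimensional 𝕜 F] : T2Space (Submodule 𝕜 F) :=
  T2Space.of_injective_continuous starProjection_injective continuous_starProjection

theorem continuous_submodule_iff [FiniteDimensional 𝕜 F] {X : Type*} [TopologicalSpace X]
    {f : X → Submodule 𝕜 F} :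
    Continuous f ↔ Continuous fun x => ((f x).starProjection : F →L[𝕜] F) :=
  continuous_induced_rng

instance [FiniteDimensional 𝕜 F] [CompleteSpace F] :
    SecondCountableTopology (unitary (F →L[𝕜] F)) := by
  have := secondCountableTopology_clm (𝕜 := 𝕜) (F := F)
  infer_instance

instance [FiniteDimensional 𝕜 F] [CompleteSpace F] :
    StandardBorelSpace (unitary (F →L[𝕜] F)) := by
  have := secondCountableTopology_clm (𝕜 := 𝕜) (F := F)
  have : PolishSpace (unitary (F →L[𝕜] F)) :=
    (isClosed_unitary (R := F →L[𝕜] F)).polishSpace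
  infer_instance

end Topology

/-! ### Haar measure on unitary groups and its transport by isometries. -/

section Haar

variable {𝕜 : Type*} [RCLike 𝕜] {F : Type*} [NormedAddCommGroup F] [InnerProductSpace 𝕜 F]
  [CompleteSpace F]
  {F' : Type*} [NormedAddCommGroup F'] [InnerProductSpace 𝕜 F'] [CompleteSpace F']

instance [FiniteDimensional 𝕜 F] : (unitaryHaar 𝕜 F).IsHaarMeasure := by
  unfold unitaryHaar; infer_instance

instance [FiniteDimensional 𝕜 F] : IsProbabilityMeasure (unitaryHaar 𝕜 F) :=
  ⟨Measure.haarMeasure_self (K₀ := (⊤ : TopologicalSpace.PositiveCompacts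
    (unitary (F →L[𝕜] F))))⟩

/-- A right translate of the Haar probability is again a Haar probability, hence is equal to it by
uniqueness. -/
theorem isMulRightInvariant_of_compactSpace {G : Type*} [Group G] [TopologicalSpace G]
    [IsTopologicalGroup G] [CompactSpace G] [MeasurableSpace G] [BorelSpace G]
    (μ : Measure G) [μ.IsHaarMeasure] [IsProbabilityMeasure μ] : μ.IsMulRightInvariant :=
  ⟨fun g => by
    have : IsProbabilityMeasure (μ.map (· * g)) :=
      Measure.isProbabilityMeasure_map (measurable_mul_const g).aemeasurable
    exact Measure.isHaarMeasure_eq_of_isProbabilityMeasure _ _⟩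

instance [FiniteDimensional 𝕜 F] : (unitaryHaar 𝕜 F).IsMulRightInvariant :=
  isMulRightInvariant_of_compactSpace _

/-- Transport of unitary operators along two isometries. -/
def unitaryTransport (φ χ : F ≃ₗᵢ[𝕜] F') (u : unitary (F →L[𝕜] F)) : unitary (F' →L[𝕜] F') :=
  Unitary.linearIsometryEquiv.symm ((χ.symm.trans (Unitary.linearIsometryEquiv u)).trans φ)

theorem unitaryTransport_apply (φ χ : F ≃ₗᵢ[𝕜] F') (u : unitary (F →L[𝕜] F)) (x : F') :
    (unitaryTransport φ χ u : F' →L[𝕜] F') x = φ ((u : F →L[𝕜] F) (χ.symm x)) := rfl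

theorem continuous_unitaryTransport (φ χ : F ≃ₗᵢ[𝕜] F') :
    Continuous (unitaryTransport φ χ) := by
  refine Continuous.subtype_mk (f := fun u : unitary (F →L[𝕜] F) =>
    ((φ : F ≃L[𝕜] F') : F →L[𝕜] F') ∘L (u : F →L[𝕜] F) ∘L
      ((χ.symm : F' ≃L[𝕜] F) : F' →L[𝕜] F)) ?_ _
  exact continuous_const.clm_comp (continuous_subtype_val.clm_comp continuous_const)

/-- Conjugation by an isometry, as an isomorphism of unitary groups. -/
def unitaryConj (φ : F ≃ₗᵢ[𝕜] F') : unitary (F →L[𝕜] F) ≃* unitary (F' →L[𝕜] F') where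
  toFun := unitaryTransport φ φ
  invFun := unitaryTransport φ.symm φ.symm
  left_inv u := by
    apply Subtype.ext; ext x; simp [unitaryTransport_apply]
  right_inv u := by
    apply Subtype.ext; ext x; simp [unitaryTransport_apply]
  map_mul' u v := by
    apply Subtype.ext; ext x; simp [unitaryTransport_apply]

/-- Transport along two different isometries is conjugation by the first, a group isomorphism,
followed by right multiplication by a fixed element; both respect the normalised Haar measures. -/
theorem map_unitaryTransport [FiniteDimensional 𝕜 F] [FiniteDimensional 𝕜 F']
    (φ χ : F ≃ₗᵢ[𝕜] F') :
    (unitaryHaar 𝕜 F).map (unitaryTransport φ χ) = unitaryHaar 𝕜 F' := by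
  let w : unitary (F' →L[𝕜] F') := Unitary.linearIsometryEquiv.symm (χ.symm.trans φ)
  have h : unitaryTransport φ χ = (fun u => u * w) ∘ unitaryConj φ := by
    funext u
    apply Subtype.ext; ext x
    change φ _ = φ ((u : F →L[𝕜] F) (φ.symm (φ (χ.symm x))))
    rw [φ.symm_apply_apply]
    rfl
  have hc : Continuous (unitaryConj φ) := continuous_unitaryTransport φ φ
  have : ((unitaryHaar 𝕜 F).map (unitaryConj φ)).IsHaarMeasure :=
    MulEquiv.isHaarMeasure_map _ _ hc (continuous_unitaryTransport φ.symm φ.symm)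
  have : IsProbabilityMeasure ((unitaryHaar 𝕜 F).map (unitaryConj φ)) :=
    Measure.isProbabilityMeasure_map hc.measurable.aemeasurable
  rw [h, ← Measure.map_map (measurable_mul_const w) hc.measurable,
    Measure.isHaarMeasure_eq_of_isProbabilityMeasure ((unitaryHaar 𝕜 F).map (unitaryConj φ))
      (unitaryHaar 𝕜 F'), map_mul_right_eq_self]

end Haar

/-! ### Rotated orthonormal bases and their coordinate subspaces. -/

section Rotate

variable {𝕜 : Type*} [RCLike 𝕜] {F : Type*} [NormedAddCommGroup F] [InnerProductSpace 𝕜 F]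
  {α : Type*} [Fintype α]

/-- The group of isometries of `𝕜^α`. -/
abbrev UnitaryGrp (𝕜 : Type*) [RCLike 𝕜] (α : Type*) [Fintype α] : Type _ :=
  unitary (EuclideanSpace 𝕜 α →L[𝕜] EuclideanSpace 𝕜 α)

/-- The orthonormal basis obtained from `b` by the isometry whose matrix in `b` is `v`. -/
def rotate (b : OrthonormalBasis α 𝕜 F) (v : UnitaryGrp 𝕜 α) : OrthonormalBasis α 𝕜 F :=
  ((EuclideanSpace.basisFun α 𝕜).map (Unitary.linearIsometryEquiv v)).map b.repr.symm

theorem rotate_apply (b : OrthonormalBasis α 𝕜 F) (v : UnitaryGrp 𝕜 α) (j : α) :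
    rotate b v j = b.repr.symm ((v : EuclideanSpace 𝕜 α →L[𝕜] EuclideanSpace 𝕜 α)
      (EuclideanSpace.basisFun α 𝕜 j)) := rfl

theorem continuous_rotate (b : OrthonormalBasis α 𝕜 F) (j : α) :
    Continuous fun v : UnitaryGrp 𝕜 α => rotate b v j := by
  simp only [rotate_apply]
  exact b.repr.symm.continuous.comp (continuous_subtype_val.clm_apply continuous_const)

theorem exists_rotate_eq (b c : OrthonormalBasis α 𝕜 F) : ∃ v : UnitaryGrp 𝕜 α, rotate b v = c := by
  classical
  refine ⟨Unitary.linearIsometryEquiv.symm (c.repr.symm.trans b.repr), ?_⟩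
  apply DFunLike.ext
  intro j
  change b.repr.symm (b.repr (c.repr.symm (EuclideanSpace.basisFun α 𝕜 j))) = c j
  rw [b.repr.symm_apply_apply, EuclideanSpace.basisFun_apply, c.repr_symm_single]

/-- The sum of rank-one projections depends continuously on the frame, which makes the spanned
subspace a continuous function of it. -/
theorem starProjection_span_image {ι : Type*} {c : ι → F} (hc : Orthonormal 𝕜 c) (I : Finset ι)
    [(Submodule.span 𝕜 (c '' I)).HasOrthogonalProjection] :
    (Submodule.span 𝕜 (c '' I)).starProjection =
      ∑ j ∈ I, InnerProductSpace.rankOne 𝕜 (c j) (c j) := by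
  classical
  ext x
  refine Submodule.eq_starProjection_of_mem_orthogonal ?_ ?_
  · simp only [sum_apply, InnerProductSpace.rankOne_apply]
    exact Submodule.sum_mem _ fun j hj =>
      Submodule.smul_mem _ _ (Submodule.subset_span ⟨j, hj, rfl⟩)
  · rw [Submodule.mem_orthogonal]
    intro y hy
    induction hy using Submodule.span_induction with
    | mem y hy =>
      obtain ⟨i, hi, rfl⟩ := hy
      have hi' : i ∈ I := hi
      simp only [sum_apply, InnerProductSpace.rankOne_apply, inner_sub_right,
        inner_sum, inner_smul_right, orthonormal_iff_ite.1 hc]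
      simp [hi']
    | zero => simp
    | add y z _ _ hy hz => rw [inner_add_left, hy, hz, add_zero]
    | smul a y _ hy => rw [inner_smul_left, hy, mul_zero]

theorem continuous_span_image [FiniteDimensional 𝕜 F] {X ι : Type*} [TopologicalSpace X]
    {c : X → ι → F} (hc : ∀ x, Orthonormal 𝕜 (c x)) (hcont : ∀ j, Continuous fun x => c x j)
    (I : Finset ι) : Continuous fun x => Submodule.span 𝕜 (c x '' I) := by
  rw [continuous_submodule_iff]
  simp only [fun x => starProjection_span_image (hc x) I]
  refine continuous_finsetSum _ fun j _ => ?_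
  simp only [InnerProductSpace.rankOne_def]
  exact ContinuousLinearMap.continuous₂ (ContinuousLinearMap.smulRightL 𝕜 F F)
    |>.comp (((innerSL 𝕜).continuous.comp (hcont j)).prodMk (hcont j))

theorem finrank_span_image {ι : Type*} {c : ι → F} (hc : Orthonormal 𝕜 c) (I : Finset ι) :
    Module.finrank 𝕜 (Submodule.span 𝕜 (c '' I)) = I.card := by
  have := finrank_span_eq_card (R := 𝕜) (b := fun j : I => c j)
    (hc.linearIndependent.comp _ Subtype.val_injective)
  have himg : c '' (I : Set ι) = Set.range fun j : I => c j := by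
    ext x; simp
  rw [himg, this, Fintype.card_coe]

theorem exists_span_image_eq [FiniteDimensional 𝕜 F] (b : OrthonormalBasis α 𝕜 F)
    (Q : Submodule 𝕜 F) :
    ∃ (I : Finset α) (v : UnitaryGrp 𝕜 α), Submodule.span 𝕜 (rotate b v '' I) = Q := by
  classical
  have hcard : Module.finrank 𝕜 F = Fintype.card α := by
    simpa using Module.finrank_eq_card_basis b.toBasis
  obtain ⟨I, -, hI⟩ := Finset.exists_subset_card_eq (s := (Finset.univ : Finset α))
    (n := Module.finrank 𝕜 Q) (by rw [Finset.card_univ, ← hcard]; exact Q.finrank_le)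
  let e : I ≃ Fin (Module.finrank 𝕜 Q) := I.equivFinOfCardEq hI
  let q := stdOrthonormalBasis 𝕜 Q
  -- The value 0 outside `I` is filler: the extension to an orthonormal basis only uses `w` on `I`.
  let w : α → F := fun j => if h : j ∈ I then (q (e ⟨j, h⟩) : F) else 0
  have hw : ∀ j : I, w j = q (e j) := fun j => by simp [w]
  have ho : Orthonormal 𝕜 ((I : Set α).domRestrict w) := by
    have : (I : Set α).domRestrict w = (Q.subtypeₗᵢ ∘ q) ∘ e := by
      funext j; exact hw j
    rw [this]
    exact (q.orthonormal.comp_linearIsometry _).comp _ e.injective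
  obtain ⟨c, hc⟩ := ho.exists_orthonormalBasis_extension_of_card_eq hcard
  obtain ⟨v, hv⟩ := exists_rotate_eq b c
  refine ⟨I, v, ?_⟩
  rw [hv]
  have himg : c '' (I : Set α) = Q.subtype '' Set.range q := by
    ext x
    constructor
    · rintro ⟨j, hj, rfl⟩
      exact ⟨_, ⟨e ⟨j, hj⟩, rfl⟩, ((hc j hj).trans (hw ⟨j, hj⟩)).symm⟩
    · rintro ⟨_, ⟨l, rfl⟩, rfl⟩
      refine ⟨(e.symm l : α), (e.symm l).2, ?_⟩
      rw [hc _ (e.symm l).2, hw, e.apply_symm_apply]; rfl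
  have hspan : Submodule.span 𝕜 (Set.range q) = ⊤ := by
    simpa using q.toBasis.span_eq
  rw [himg, Submodule.span_image, hspan, Submodule.map_top, Submodule.range_subtype]

end Rotate

/-! ### Invariant measures as laws of rotated coordinate subspaces. -/

section Total

variable {𝕜 : Type*} [RCLike 𝕜] {F : Type*} [NormedAddCommGroup F] [InnerProductSpace 𝕜 F]
  [FiniteDimensional 𝕜 F] {α : Type*} [Fintype α]

/-- The sum over all dimensions of the invariant measures on the Grassmannian is obtained by
rotating the coordinate subspaces of any orthonormal basis. -/
theorem sum_grassmannMeasure (b : OrthonormalBasis α 𝕜 F) :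
    ∑ n ∈ Finset.range (Module.finrank 𝕜 F + 1), grassmannMeasure 𝕜 F n =
      ∑ I : Finset α, (unitaryHaar 𝕜 (EuclideanSpace 𝕜 α)).map fun v =>
        Submodule.span 𝕜 (rotate b v '' (I : Set α)) := by
  classical
  have : CompleteSpace F := FiniteDimensional.complete 𝕜 F
  have hcard : Fintype.card (Fin (Module.finrank 𝕜 F)) = Fintype.card α := by
    simpa using Module.finrank_eq_card_basis b.toBasis
  let τ : Fin (Module.finrank 𝕜 F) ≃ α := Fintype.equivOfCardEq hcard
  let e : OrthonormalBasis α 𝕜 F := (stdOrthonormalBasis 𝕜 F).reindex τ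
  have h1 : ∑ n ∈ Finset.range (Module.finrank 𝕜 F + 1), grassmannMeasure 𝕜 F n =
      ∑ J : Finset (Fin (Module.finrank 𝕜 F)), (unitaryHaar 𝕜 F).map fun u : unitary (F →L[𝕜] F) =>
        (Submodule.span 𝕜 (stdOrthonormalBasis 𝕜 F '' (J : Set (Fin (Module.finrank 𝕜 F))))).map
          ((u : F →L[𝕜] F) : F →ₗ[𝕜] F) := by
    have := Finset.sum_powerset (Finset.univ : Finset (Fin (Module.finrank 𝕜 F)))
      fun J => (unitaryHaar 𝕜 F).map fun u : unitary (F →L[𝕜] F) =>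
        (Submodule.span 𝕜 (stdOrthonormalBasis 𝕜 F '' (J : Set (Fin (Module.finrank 𝕜 F))))).map
          ((u : F →L[𝕜] F) : F →ₗ[𝕜] F)
    rw [Finset.powerset_univ, Finset.card_univ, Fintype.card_fin] at this
    exact this.symm
  rw [h1]
  refine Fintype.sum_equiv τ.finsetCongr _ _ fun J => ?_
  -- The two isometries differ on purpose: `e`, the reindexed standard basis, reads the coordinates
  -- and `b` rebuilds the vector, so that the standard basis used in `grassmannMeasure` is exchanged
  -- for `b`.
  have key : ∀ v : UnitaryGrp 𝕜 α,
      (Submodule.span 𝕜 (stdOrthonormalBasis 𝕜 F '' (J : Set (Fin (Module.finrank 𝕜 F))))).map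
          ((unitaryTransport b.repr.symm e.repr.symm v : F →L[𝕜] F) : F →ₗ[𝕜] F) =
        Submodule.span 𝕜 (rotate b v '' (τ.finsetCongr J : Set α)) := by
    intro v
    rw [Submodule.map_span, ← Set.image_comp]
    have : (τ.finsetCongr J : Set α) = τ '' (J : Set (Fin (Module.finrank 𝕜 F))) := by simp
    rw [this, ← Set.image_comp]
    congr 1
    refine Set.image_congr fun j _ => ?_
    have he : e.repr (stdOrthonormalBasis 𝕜 F j) = EuclideanSpace.basisFun α 𝕜 (τ j) := by
      have : stdOrthonormalBasis 𝕜 F j = e (τ j) := by simp [e]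
      rw [this, OrthonormalBasis.repr_self, EuclideanSpace.basisFun_apply]
    change b.repr.symm ((v : EuclideanSpace 𝕜 α →L[𝕜] EuclideanSpace 𝕜 α)
      (e.repr (stdOrthonormalBasis 𝕜 F j))) = rotate b v (τ j)
    rw [he, rotate_apply]
  simp only [← key]
  rw [← map_unitaryTransport b.repr.symm e.repr.symm, Measure.map_map ?_
    (continuous_unitaryTransport _ _).measurable]
  · rfl
  · refine Continuous.measurable ?_
    simp only [Submodule.map_span, ← Set.image_comp]
    refine continuous_span_image (𝕜 := 𝕜)
      (c := fun (u : unitary (F →L[𝕜] F)) j => (u : F →L[𝕜] F) (stdOrthonormalBasis 𝕜 F j))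
      (fun u => ?_) (fun j => continuous_subtype_val.clm_apply continuous_const) J
    exact (stdOrthonormalBasis 𝕜 F).orthonormal.comp_linearIsometryEquiv
      (Unitary.linearIsometryEquiv u)

end Total

theorem pi_sum_measure {ι : Type*} [Fintype ι] {κ : ι → Type*} {X : ι → Type*}
    [∀ i, MeasurableSpace (X i)] (t : ∀ i, Finset (κ i)) (μ : ∀ i, κ i → Measure (X i))
    [∀ i k, IsFiniteMeasure (μ i k)] [DecidableEq ι] :
    Measure.pi (fun i => ∑ k ∈ t i, μ i k) =
      ∑ n ∈ Fintype.piFinset t, Measure.pi fun i => μ i (n i) := by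
  refine Measure.pi_eq fun s _ => ?_
  simp only [Measure.coe_finsetSum, Finset.sum_apply, Measure.pi_pi]
  rw [Finset.prod_univ_sum]

theorem map_sum_measure {ι X Y : Type*} [MeasurableSpace X] [MeasurableSpace Y] (t : Finset ι)
    (μ : ι → Measure X) {f : X → Y} (hf : Measurable f) :
    (∑ k ∈ t, μ k).map f = ∑ k ∈ t, (μ k).map f := by
  ext s hs
  simp only [Measure.map_apply hf hs, Measure.coe_finsetSum, Finset.sum_apply]

instance {𝕜 : Type*} [RCLike 𝕜] {F : Type*} [NormedAddCommGroup F] [InnerProductSpace 𝕜 F]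
    [FiniteDimensional 𝕜 F] (n : ℕ) : IsFiniteMeasure (grassmannMeasure 𝕜 F n) := by
  unfold grassmannMeasure; infer_instance

/-! ### Adapted subspaces spanned by frames, and the measures ν^{W}. -/

namespace Splitting

variable {𝕜 : Type*} [RCLike 𝕜] {E : Type*} [NormedAddCommGroup E] [InnerProductSpace 𝕜 E]
  (σ : Splitting 𝕜 E)

theorem orthogonalFamily_of_le {W : Fin σ.s → Submodule 𝕜 E} (hW : ∀ i, W i ≤ σ.V i) :
    OrthogonalFamily 𝕜 (fun i => W i) fun i => (W i).subtypeₗᵢ :=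
  OrthogonalFamily.of_pairwise fun i j hij => (σ.orthogonal i j hij).mono (hW i) (hW j)

/-- Modular law: the summands other than `R i` are orthogonal to `σ.V i`. -/
theorem iSup_inf_eq {R : Fin σ.s → Submodule 𝕜 E} (hR : ∀ i, R i ≤ σ.V i) (i : Fin σ.s) :
    (⨆ j, R j) ⊓ σ.V i = R i := by
  have h1 : (⨆ j, R j) = R i ⊔ ⨆ (j) (_ : j ≠ i), R j := iSup_split_single R i
  have h2 : (⨆ (j) (_ : j ≠ i), R j) ⟂ σ.V i := by
    simp only [Submodule.isOrtho_iSup_left]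
    exact fun j hj => (σ.orthogonal j i hj).mono_left (hR j)
  rw [h1, sup_inf_assoc_of_le _ (hR i), h2.disjoint.eq_bot, sup_bot_eq]

/-- The sum of the subspaces spanned by the vectors `b i j`, `j ∈ I i`, as an element of the split
Grassmannian. -/
def frameSum {W : Fin σ.s → Submodule 𝕜 E} (hW : ∀ i, W i ≤ σ.V i) {α : Fin σ.s → Type*}
    [∀ i, Fintype (α i)] (b : ∀ i, OrthonormalBasis (α i) 𝕜 (W i)) (I : ∀ i, Finset (α i)) :
    σ.Gr :=
  σ.directSum W hW fun i => Submodule.span 𝕜 (b i '' I i)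

variable {σ}
variable {W : Fin σ.s → Submodule 𝕜 E} {hW : ∀ i, W i ≤ σ.V i} {α : Fin σ.s → Type*}
  [∀ i, Fintype (α i)] {b : ∀ i, OrthonormalBasis (α i) 𝕜 (W i)}

theorem coe_frameSum (I : ∀ i, Finset (α i)) :
    (σ.frameSum hW b I).1 = ⨆ i, Submodule.span 𝕜 ((fun j => (b i j : E)) '' I i) := by
  simp only [frameSum, directSum, Submodule.map_span, ← Set.image_comp]
  rfl

theorem coe_frameSum_eq_span (I : ∀ i, Finset (α i)) :
    (σ.frameSum hW b I).1 =
      Submodule.span 𝕜 ((fun a : Σ i, α i => (b a.1 a.2 : E)) '' (Finset.univ.sigma I)) := by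
  rw [coe_frameSum, ← Submodule.span_iUnion]
  congr 1
  ext x
  simp

theorem orthonormal_sigma (hW : ∀ i, W i ≤ σ.V i) (b : ∀ i, OrthonormalBasis (α i) 𝕜 (W i)) :
    Orthonormal 𝕜 fun a : Σ i, α i => (b a.1 a.2 : E) :=
  (σ.orthogonalFamily_of_le hW).orthonormal_sigma_orthonormal fun i => (b i).orthonormal

theorem finrank_frameSum (I : ∀ i, Finset (α i)) :
    Module.finrank 𝕜 (σ.frameSum hW b I).1 = ∑ i, (I i).card := by
  rw [coe_frameSum_eq_span, finrank_span_image (orthonormal_sigma hW b), Finset.card_sigma]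

theorem frameSum_inf (I : ∀ i, Finset (α i)) (i : Fin σ.s) :
    (σ.frameSum hW b I).1 ⊓ σ.V i = Submodule.span 𝕜 ((fun j => (b i j : E)) '' I i) := by
  rw [coe_frameSum, σ.iSup_inf_eq]
  intro i
  rw [Submodule.span_le]
  rintro _ ⟨j, _, rfl⟩
  exact hW i (b i j).2

theorem coe_frameSum_univ :
    (σ.frameSum hW b fun _ => Finset.univ).1 = ⨆ i, W i := by
  simp only [frameSum, directSum]
  congr 1
  funext i
  have : Submodule.span 𝕜 (Set.range (b i)) = ⊤ := by simpa using (b i).toBasis.span_eq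
  rw [Finset.coe_univ, Set.image_univ, this, Submodule.map_top, Submodule.range_subtype]

variable [FiniteDimensional 𝕜 E]

theorem starProjection_directSum (hW : ∀ i, W i ≤ σ.V i) (Q : ∀ i, Submodule 𝕜 (W i)) :
    (σ.directSum W hW Q).1.starProjection =
      ∑ i, (W i).subtypeL ∘L (Q i).starProjection ∘L (W i).orthogonalProjectionOnto := by
  ext x
  refine Submodule.eq_starProjection_of_mem_orthogonal ?_ ?_
  · rw [sum_apply]
    exact Submodule.sum_mem _ fun i _ => Submodule.mem_iSup_of_mem i
      ⟨_, Submodule.starProjection_apply_mem (Q i) _, rfl⟩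
  · change _ ∈ (⨆ i, (Q i).map (W i).subtype)ᗮ
    rw [← Submodule.iInf_orthogonal, Submodule.mem_iInf]
    intro i
    rw [Submodule.mem_orthogonal]
    rintro _ ⟨y, hy, rfl⟩
    have h0 : ∀ j, j ≠ i → inner 𝕜 (y : E)
        ((Q j).starProjection ((W j).orthogonalProjectionOnto x) : E) = 0 := fun j hj =>
      ((σ.orthogonal i j hj.symm).mono (hW i) (hW j)).inner_eq y.2 (Subtype.coe_prop _)
    have hsum : inner 𝕜 (y : E) ((∑ i, (W i).subtypeL ∘L (Q i).starProjection ∘L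
        (W i).orthogonalProjectionOnto) x) =
        inner 𝕜 (y : E) (((Q i).starProjection ((W i).orthogonalProjectionOnto x) : W i) : E) := by
      rw [sum_apply, inner_sum]
      exact Finset.sum_eq_single i (fun j _ hj => h0 j hj) fun h => absurd (Finset.mem_univ i) h
    rw [inner_sub_right, Submodule.subtype_apply, hsum]
    change inner 𝕜 (y : E) x - inner 𝕜 (y : E)
      (((Q i).starProjection ((W i).orthogonalProjectionOnto x) : W i) : E) = 0
    rw [← Submodule.coe_inner, ← Submodule.inner_starProjection_left_eq_right,
      Submodule.starProjection_eq_self_iff.2 hy,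
      Submodule.inner_orthogonalProjectionOnto_eq_of_mem_left, sub_self]

theorem continuous_directSum (hW : ∀ i, W i ≤ σ.V i) : Continuous (σ.directSum W hW) := by
  refine Continuous.subtype_mk ?_ _
  rw [continuous_submodule_iff]
  have := starProjection_directSum (σ := σ) hW
  simp only [directSum] at this
  simp only [this]
  refine continuous_finsetSum _ fun i _ => ?_
  exact continuous_const.clm_comp
    ((continuous_starProjection.comp (continuous_apply i)).clm_comp continuous_const)

/-- The product of the normalised Haar measures on unitary groups. -/
def haarPi (𝕜 : Type*) [RCLike 𝕜] {s : ℕ} (α : Fin s → Type*) [∀ i, Fintype (α i)] :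
    Measure (∀ i, UnitaryGrp 𝕜 (α i)) :=
  Measure.pi fun i => unitaryHaar 𝕜 (EuclideanSpace 𝕜 (α i))

instance {s : ℕ} (α : Fin s → Type*) [∀ i, Fintype (α i)] :
    IsProbabilityMeasure (haarPi 𝕜 α) := by
  unfold haarPi; infer_instance

instance {s : ℕ} (α : Fin s → Type*) [∀ i, Fintype (α i)] :
    (haarPi 𝕜 α).IsMulRightInvariant := by
  have h1 : ∀ i, SigmaFinite (unitaryHaar 𝕜 (EuclideanSpace 𝕜 (α i))) := fun i => inferInstance
  have h2 : ∀ i, (unitaryHaar 𝕜 (EuclideanSpace 𝕜 (α i))).IsMulRightInvariant :=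
    fun i => inferInstance
  have h3 : ∀ i, MeasurableMul (UnitaryGrp 𝕜 (α i)) := fun i => inferInstance
  exact Measure.pi.isMulRightInvariant _

instance {s : ℕ} (α : Fin s → Type*) [∀ i, Fintype (α i)] : SFinite (haarPi 𝕜 α) := by
  have h1 : IsFiniteMeasure (haarPi 𝕜 α) :=
    ⟨by rw [measure_univ]; exact ENNReal.one_lt_top⟩
  have h2 : SigmaFinite (haarPi 𝕜 α) := IsFiniteMeasure.toSigmaFinite _
  exact instSFiniteOfSigmaFinite

theorem continuous_span_rotate {F : Type*} [NormedAddCommGroup F] [InnerProductSpace 𝕜 F]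
    [FiniteDimensional 𝕜 F] {β : Type*} [Fintype β] (c : OrthonormalBasis β 𝕜 F) (I : Finset β) :
    Continuous fun v : UnitaryGrp 𝕜 β => Submodule.span 𝕜 (rotate c v '' I) :=
  continuous_span_image (fun v => (rotate c v).orthonormal) (fun j => continuous_rotate c j) I

theorem continuous_frameSum_rotate (hW : ∀ i, W i ≤ σ.V i)
    (b : ∀ i, OrthonormalBasis (α i) 𝕜 (W i)) (I : ∀ i, Finset (α i)) :
    Continuous fun v : ∀ i, UnitaryGrp 𝕜 (α i) =>
      σ.frameSum hW (fun i => rotate (b i) (v i)) I :=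
  (continuous_directSum hW).comp (continuous_pi fun i =>
    (continuous_span_rotate (b i) (I i)).comp (continuous_apply i))

/-- The sum over split dimensions of product measures is the product of the sums over dimensions.
Each factor is a sum over coordinate subsets, and the product is then expanded again, now over
families of subsets. -/
theorem splitMeasure_eq_sum (hW : ∀ i, W i ≤ σ.V i) (b : ∀ i, OrthonormalBasis (α i) 𝕜 (W i)) :
    σ.splitMeasure W hW = ∑ I : ∀ i, Finset (α i), (haarPi 𝕜 α).map fun v =>
      σ.frameSum hW (fun i => rotate (b i) (v i)) I := by
  classical
  have hD : Measurable (σ.directSum W hW) := (continuous_directSum hW).measurable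
  rw [splitMeasure, ← map_sum_measure _ _ hD, ← pi_sum_measure]
  simp only [fun i => sum_grassmannMeasure (b i)]
  rw [pi_sum_measure (fun _ => Finset.univ), map_sum_measure _ _ hD, Fintype.piFinset_univ]
  refine Finset.sum_congr rfl fun I _ => ?_
  rw [← Measure.pi_map_pi fun i => (continuous_span_rotate (b i) (I i)).measurable.aemeasurable,
    Measure.map_map hD]
  · rfl
  · exact measurable_pi_lambda _ fun i =>
      (continuous_span_rotate (b i) (I i)).measurable.comp (measurable_pi_apply i)

end Splitting

/-! ### Determinant identities and positivity. -/

section Det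

theorem det_one_add_comp_comm {K V W : Type*} [Field K] [AddCommGroup V] [Module K V]
    [AddCommGroup W] [Module K W] [FiniteDimensional K V] [FiniteDimensional K W]
    (A : W →ₗ[K] V) (B : V →ₗ[K] W) :
    LinearMap.det (1 + A ∘ₗ B) = LinearMap.det (1 + B ∘ₗ A) := by
  let v := Module.finBasis K V
  let w := Module.finBasis K W
  rw [← LinearMap.det_toMatrix v, ← LinearMap.det_toMatrix w, map_add, map_add,
    LinearMap.toMatrix_one, LinearMap.toMatrix_one, LinearMap.toMatrix_comp v w v,
    LinearMap.toMatrix_comp w v w, Matrix.det_one_add_mul_comm]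

variable {𝕜 : Type*} [RCLike 𝕜] {E : Type*} [NormedAddCommGroup E] [InnerProductSpace 𝕜 E]
  [FiniteDimensional 𝕜 E]

/-- The endomorphism `k Π_Q + (1 - k) Π_{Q^⊥}`. -/
def mixedOp (k : E →ₗ[𝕜] E) (Q : Submodule 𝕜 E) : E →ₗ[𝕜] E :=
  k ∘ₗ (Q.starProjection : E →ₗ[𝕜] E) + (1 - k) ∘ₗ (Qᗮ.starProjection : E →ₗ[𝕜] E)

theorem mixedOp_apply (k : E →ₗ[𝕜] E) (Q : Submodule 𝕜 E) (x : E) :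
    mixedOp k Q x =
      k (Q.starProjection x) + (x - Q.starProjection x - k (x - Q.starProjection x)) := by
  have h : Qᗮ.starProjection x = x - Q.starProjection x := by
    rw [Submodule.starProjection_orthogonal]; rfl
  simp only [mixedOp, LinearMap.add_apply, LinearMap.comp_apply, LinearMap.sub_apply,
    ContinuousLinearMap.coe_coe, h, Module.End.one_apply]

/-- Sylvester's identity det(1 + AB) = det(1 + BA), with A = (k - 1) restricted to Q and B the
projection onto Q, moves the determinant from the varying space Q to E. -/
theorem det_compression (k : E →ₗ[𝕜] E) (Q : Submodule 𝕜 E) :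
    LinearMap.det (compression k Q) =
      LinearMap.det (1 + (k - 1) ∘ₗ (Q.starProjection : E →ₗ[𝕜] E)) := by
  have h1 : 1 + (k - 1) ∘ₗ (Q.starProjection : E →ₗ[𝕜] E) =
      1 + ((k - 1) ∘ₗ Q.subtype) ∘ₗ (Q.orthogonalProjectionOnto : E →ₗ[𝕜] Q) := rfl
  have h2 : compression k Q =
      1 + (Q.orthogonalProjectionOnto : E →ₗ[𝕜] Q) ∘ₗ ((k - 1) ∘ₗ Q.subtype) := by
    ext x
    simp [compression]
  rw [h1, det_one_add_comp_comm, h2]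

theorem starProjection_span_image_apply {ι : Type*} [Fintype ι] [DecidableEq ι]
    (c : OrthonormalBasis ι 𝕜 E) (J : Finset ι) (j : ι) :
    (Submodule.span 𝕜 (c '' J)).starProjection (c j) = if j ∈ J then c j else 0 := by
  rw [starProjection_span_image c.orthonormal, sum_apply]
  simp [orthonormal_iff_ite.1 c.orthonormal]

/-- Multilinearity of the determinant in its columns: each index outside `I` chooses freely between
k c_j and c_j - k c_j, whose sum is c_j. -/
theorem sum_det_mixedOp {ι : Type*} [Fintype ι] [DecidableEq ι]
    (k : E →ₗ[𝕜] E) (c : OrthonormalBasis ι 𝕜 E) (I : Finset ι) :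
    ∑ J : Finset ι with I ⊆ J, LinearMap.det (mixedOp k (Submodule.span 𝕜 (c '' J))) =
      LinearMap.det (compression k (Submodule.span 𝕜 (c '' I))) := by
  have hdet : ∀ f : E →ₗ[𝕜] E, LinearMap.det f = c.toBasis.det (f ∘ c) := by
    intro f
    have := c.toBasis.det_comp f c.toBasis
    rw [Module.Basis.det_self, mul_one] at this
    rw [← this, OrthonormalBasis.coe_toBasis]
  let m : ι → E := fun j => k (c j)
  let m' : ι → E := fun j => c j - k (c j)
  have h1 : ∀ J : Finset ι, LinearMap.det (mixedOp k (Submodule.span 𝕜 (c '' J))) =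
      c.toBasis.det (J.piecewise m m') := by
    intro J
    rw [hdet]
    congr 1
    funext j
    by_cases hj : j ∈ J <;>
      simp [mixedOp_apply, starProjection_span_image_apply, hj, m, m']
  -- The columns are k c_j on `I` and m + m' = c_j off `I`; they are written in this way to fit the
  -- form f(t.piecewise (m + m') m') of the multilinear expansion.
  have h2 : LinearMap.det (compression k (Submodule.span 𝕜 (c '' I))) =
      c.toBasis.det (Iᶜ.piecewise (m + I.piecewise m m') (I.piecewise m m')) := by
    rw [det_compression, hdet]
    congr 1
    funext j
    by_cases hj : j ∈ I <;>
      simp [starProjection_span_image_apply, hj, m, m']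
  rw [h2]
  change _ = c.toBasis.det.toMultilinearMap _
  rw [MultilinearMap.map_piecewise_add]
  simp only [h1]
  refine Finset.sum_nbij' (fun J => J \ I) (fun s => s ∪ I) ?_ ?_ ?_ ?_ ?_
  · intro J _
    simp only [Finset.mem_powerset]
    intro j hj
    simpa using (Finset.mem_sdiff.1 hj).2
  · intro s _
    simp
  · intro J hJ
    exact Finset.sdiff_union_of_subset (by simpa using hJ)
  · intro s hs
    have : Disjoint s I := by
      rw [Finset.disjoint_left]
      intro j hj
      simpa using Finset.mem_powerset.1 hs hj
    exact Finset.union_sdiff_cancel_right this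
  · intro J hJ
    have hJ' : I ⊆ J := by simpa using hJ
    change c.toBasis.det _ = c.toBasis.det _
    congr 1
    funext j
    by_cases hj : j ∈ J <;> by_cases hi : j ∈ I
    · simp [hj, hi]
    · simp [hj, hi]
    · exact absurd (hJ' hi) hj
    · simp [hj, hi]

theorem det_adjoint (f : E →ₗ[𝕜] E) :
    LinearMap.det (LinearMap.adjoint f) = star (LinearMap.det f) := by
  classical
  let b := stdOrthonormalBasis 𝕜 E
  rw [← LinearMap.det_toMatrix b.toBasis, ← LinearMap.det_toMatrix b.toBasis,
    LinearMap.toMatrix_adjoint, Matrix.det_conjTranspose]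

/-- If `f` is accretive and its convex combinations with the identity have real determinants, then
`det f` is non-negative. -/
theorem det_nonneg_of_accretive (f : E →ₗ[𝕜] E) (hf : ∀ x, 0 ≤ RCLike.re (inner 𝕜 x (f x)))
    (hr : ∀ t : ℝ, ((RCLike.re (LinearMap.det (((1 - t : ℝ) : 𝕜) • f + (t : 𝕜) • 1)) : ℝ) : 𝕜) =
      LinearMap.det (((1 - t : ℝ) : 𝕜) • f + (t : 𝕜) • (1 : E →ₗ[𝕜] E))) :
    0 ≤ RCLike.re (LinearMap.det f) := by
  let φ : ℝ → ℝ := fun t =>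
    RCLike.re (LinearMap.det (((1 - t : ℝ) : 𝕜) • f + (t : 𝕜) • (1 : E →ₗ[𝕜] E)))
  have hcont : Continuous φ := by
    let b := Module.finBasis 𝕜 E
    have : φ = fun t : ℝ => RCLike.re (Matrix.det (((1 - t : ℝ) : 𝕜) • LinearMap.toMatrix b b f +
        (t : 𝕜) • LinearMap.toMatrix b b (1 : E →ₗ[𝕜] E))) := by
      funext t
      simp only [φ]
      rw [← LinearMap.det_toMatrix b, map_add, map_smul, map_smul]
    rw [this]
    refine RCLike.continuous_re.comp (Continuous.matrix_det ?_)
    have h1 : Continuous fun t : ℝ => ((1 - t : ℝ) : 𝕜) :=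
      RCLike.continuous_ofReal.comp (continuous_const.sub continuous_id)
    have h2 : Continuous fun t : ℝ => (t : 𝕜) := RCLike.continuous_ofReal
    exact (h1.smul continuous_const).add (h2.smul continuous_const)
  -- A kernel vector x would satisfy (1 - t) Re⟨x, f x⟩ + t ‖x‖² = 0. Reality of the determinant is
  -- what turns a zero of φ into a non-trivial kernel.
  have hne : ∀ t : ℝ, 0 < t → t ≤ 1 → φ t ≠ 0 := by
    intro t ht ht1 h0
    have hdet : LinearMap.det (((1 - t : ℝ) : 𝕜) • f + (t : 𝕜) • (1 : E →ₗ[𝕜] E)) = 0 := by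
      rw [← hr t]
      have : RCLike.re (LinearMap.det (((1 - t : ℝ) : 𝕜) • f + (t : 𝕜) • (1 : E →ₗ[𝕜] E))) = 0 := h0
      rw [this, RCLike.ofReal_zero]
    obtain ⟨x, hx, hx0⟩ := (Submodule.ne_bot_iff _).1
      (LinearMap.bot_lt_ker_of_det_eq_zero hdet).ne'
    rw [LinearMap.mem_ker] at hx
    have h := congrArg (fun y => RCLike.re (inner 𝕜 x y)) hx
    simp only [LinearMap.add_apply, LinearMap.smul_apply, Module.End.one_apply, inner_add_right,
      inner_smul_right, inner_zero_right, map_add, RCLike.re_ofReal_mul, map_zero] at h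
    have hpos : 0 < RCLike.re (inner 𝕜 x x) := by
      rw [inner_self_eq_norm_sq]
      exact pow_pos (norm_pos_iff.2 hx0) 2
    have := mul_nonneg (sub_nonneg.2 ht1) (hf x)
    have := mul_pos ht hpos
    linarith
  have h1 : φ 1 = 1 := by simp [φ]
  have hpos : ∀ t : ℝ, 0 < t → t ≤ 1 → 0 ≤ φ t := by
    intro t ht ht1
    by_contra hlt
    push Not at hlt
    obtain ⟨s, hs, hs0⟩ := intermediate_value_Icc ht1 hcont.continuousOn
      (show (0 : ℝ) ∈ Set.Icc (φ t) (φ 1) from ⟨hlt.le, by rw [h1]; exact zero_le_one⟩)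
    exact hne s (ht.trans_le hs.1) hs.2 hs0
  have h0 : φ 0 = RCLike.re (LinearMap.det f) := by simp [φ]
  rw [← h0]
  -- The endpoint is reached as a limit, since f itself may be singular.
  refine ge_of_tendsto (hcont.continuousWithinAt (s := Set.Ioi 0) (x := 0)) ?_
  filter_upwards [Ioc_mem_nhdsGT (zero_lt_one' ℝ)] with t ht using hpos t ht.1 ht.2

theorem adjoint_starProjection (Q : Submodule 𝕜 E) :
    LinearMap.adjoint (Q.starProjection : E →ₗ[𝕜] E) = (Q.starProjection : E →ₗ[𝕜] E) := by
  rw [eq_comm, LinearMap.eq_adjoint_iff]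
  exact fun x y => Submodule.inner_starProjection_left_eq_right Q x y

/-- With S = 2Π_Q - 1, the product of `mixedOp k Q` and S is the self-adjoint operator k + Π_Q - 1.
As S is a self-adjoint involution, the adjoint of `mixedOp k Q` is its conjugate by S. Real
combinations with the identity inherit this, as the homotopy argument for positivity requires. -/
theorem det_adjoint_eq_of_reflection (k : E →ₗ[𝕜] E) (hk : k.IsSymmetric) (Q : Submodule 𝕜 E)
    (a b : ℝ) :
    star (LinearMap.det ((a : 𝕜) • mixedOp k Q + (b : 𝕜) • (1 : E →ₗ[𝕜] E))) =
      LinearMap.det ((a : 𝕜) • mixedOp k Q + (b : 𝕜) • (1 : E →ₗ[𝕜] E)) := by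
  let P : E →ₗ[𝕜] E := Q.starProjection
  let S : E →ₗ[𝕜] E := 2 • P - 1
  have hP : P * P = P := by
    ext x; exact Submodule.starProjection_eq_self_iff.2 (Submodule.starProjection_apply_mem _ _)
  have hPadj : star P = P := adjoint_starProjection Q
  have hkadj : star k = k := (LinearMap.isSymmetric_iff_isSelfAdjoint k).1 hk
  have hM : mixedOp k Q = k * P + (1 - k) * (1 - P) := by
    ext x; simp [mixedOp_apply, P]
  have hPS : P * S = P := by
    simp only [S, two_smul, mul_sub, mul_add, hP, mul_one]
    abel
  have hS : S * S = 1 := by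
    have : S * S = P * S + P * S - S := by simp only [S, two_smul, sub_mul, add_mul, one_mul]
    rw [this, hPS]
    simp only [S, two_smul]
    abel
  have hMS : mixedOp k Q * S = k + P - 1 := by
    rw [hM, add_mul, mul_assoc, mul_assoc, sub_mul 1 P, hPS]
    simp only [S, two_smul, sub_mul, mul_sub, mul_add, one_mul, mul_one]
    abel
  have hSM : star (mixedOp k Q) = S * mixedOp k Q * S := by
    rw [mul_assoc, hMS, hM]
    simp only [star_add, star_mul, star_sub, star_one, hPadj, hkadj, S, two_smul, sub_mul, mul_sub,
      add_mul, mul_add, one_mul, mul_one, hP]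
    abel
  rw [← det_adjoint]
  change LinearMap.det (star _) = _
  have : star ((a : 𝕜) • mixedOp k Q + (b : 𝕜) • (1 : E →ₗ[𝕜] E)) =
      S * ((a : 𝕜) • mixedOp k Q + (b : 𝕜) • (1 : E →ₗ[𝕜] E)) * S := by
    rw [star_add, star_smul, star_smul, hSM, star_one, mul_add, add_mul, mul_smul_comm,
      smul_mul_assoc, mul_smul_comm, smul_mul_assoc, mul_one, hS]
    simp
  rw [this, map_mul, map_mul, mul_comm, ← mul_assoc, ← map_mul, hS, map_one, one_mul]

theorem det_mixedOp_nonneg (k : E →ₗ[𝕜] E) (hk : k.IsSymmetric) (hk0 : 0 ≤ k) (hk1 : k ≤ 1)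
    (Q : Submodule 𝕜 E) : 0 ≤ RCLike.re (LinearMap.det (mixedOp k Q)) := by
  refine det_nonneg_of_accretive _ (fun x => ?_) fun t => ?_
  · let p := Q.starProjection x
    let q := x - Q.starProjection x
    have hx : x = p + q := by simp [p, q]
    have hpq : inner 𝕜 p q = 0 :=
      Submodule.inner_right_of_mem_orthogonal (Submodule.starProjection_apply_mem Q x)
        (Submodule.sub_starProjection_mem_orthogonal x)
    have h1 : 0 ≤ RCLike.re (inner 𝕜 p (k p)) :=
      ((LinearMap.nonneg_iff_isPositive k).1 hk0).re_inner_nonneg_right p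
    have h2 : 0 ≤ RCLike.re (inner 𝕜 q (q - k q)) :=
      ((LinearMap.le_def k 1).1 hk1).re_inner_nonneg_right q
    -- The two cross terms of Re⟨x, M x⟩ have opposite signs and cancel, leaving ⟨p, k p⟩ + ⟨q, (1 -
    -- k) q⟩.
    have h3 : RCLike.re (inner 𝕜 q (k p)) = RCLike.re (inner 𝕜 p (k q)) := by
      rw [← hk q p, ← inner_conj_symm, RCLike.conj_re]
    rw [mixedOp_apply]
    change 0 ≤ RCLike.re (inner 𝕜 x (k p + (q - k q)))
    rw [hx]
    simp only [inner_add_left, inner_add_right, inner_sub_right, map_add, map_sub, hpq, map_zero,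
      h3] at h2 ⊢
    linarith
  · rw [← RCLike.conj_eq_iff_re]
    exact det_adjoint_eq_of_reflection k hk Q _ _

theorem re_det_mixedOp (k : E →ₗ[𝕜] E) (hk : k.IsSymmetric) (Q : Submodule 𝕜 E) :
    ((RCLike.re (LinearMap.det (mixedOp k Q)) : ℝ) : 𝕜) = LinearMap.det (mixedOp k Q) := by
  rw [← RCLike.conj_eq_iff_re]
  simpa using det_adjoint_eq_of_reflection k hk Q 1 0

theorem continuous_linearMapDet {X : Type*} [TopologicalSpace X] {f : X → E →L[𝕜] E}
    (hf : Continuous f) : Continuous fun x => LinearMap.det (f x : E →ₗ[𝕜] E) := by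
  let b := stdOrthonormalBasis 𝕜 E
  simp only [← LinearMap.det_toMatrix b.toBasis]
  refine Continuous.matrix_det (continuous_matrix fun i j => ?_)
  simp only [LinearMap.toMatrix_apply]
  exact (LinearMap.continuous_of_finiteDimensional (b.toBasis.coord i)).comp
    (hf.clm_apply continuous_const)

theorem continuous_det_mixedOp (k : E →ₗ[𝕜] E) :
    Continuous fun Q : Submodule 𝕜 E => LinearMap.det (mixedOp k Q) := by
  have h : Continuous fun Q : Submodule 𝕜 E => k.toContinuousLinearMap ∘L Q.starProjection +
      (1 - k).toContinuousLinearMap ∘L (1 - Q.starProjection) :=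
    (continuous_const.clm_comp continuous_starProjection).add
      (continuous_const.clm_comp (continuous_const.sub continuous_starProjection))
  convert continuous_linearMapDet h using 3 with Q
  ext x
  rw [mixedOp_apply]
  simp
  abel

theorem continuous_det_compression (k : E →ₗ[𝕜] E) :
    Continuous fun Q : Submodule 𝕜 E => LinearMap.det (compression k Q) := by
  have h : Continuous fun Q : Submodule 𝕜 E =>
      1 + (k - 1).toContinuousLinearMap ∘L Q.starProjection :=
    continuous_const.add (continuous_const.clm_comp continuous_starProjection)
  convert continuous_linearMapDet h using 3 with Q
  rw [det_compression]
  rfl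

end Det

/-! ### Isometries acting on a block of coordinates. -/

section Block

variable {𝕜 : Type*} [RCLike 𝕜]

/-- The extension by the identity of an isometry of `G` along an embedding of `G` into `F`. -/
def extendAlong {F G : Type*} [NormedAddCommGroup F] [InnerProductSpace 𝕜 F] [CompleteSpace F]
    [NormedAddCommGroup G] [InnerProductSpace 𝕜 G] [CompleteSpace G] (A : G →ₗᵢ[𝕜] F)
    (v : unitary (G →L[𝕜] G)) : unitary (F →L[𝕜] F) := by
  let T : G →L[𝕜] F := A.toContinuousLinearMap
  let T' : F →L[𝕜] G := ContinuousLinearMap.adjoint T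
  -- T T' is the orthogonal projection onto the range of `A`, so `X w` is `w` there and the identity
  -- on the complement.
  let X : (G →L[𝕜] G) → (F →L[𝕜] F) := fun w => T ∘L w ∘L T' + (1 - T ∘L T')
  have hT : ∀ y, T' (T y) = y := fun y => by
    have := (ContinuousLinearMap.norm_map_iff_adjoint_comp_self T).1 A.norm_map
    exact congrArg (fun f : G →L[𝕜] G => f y) this
  have hstar : ∀ w, star (X w) = X (star w) := fun w => by
    simp only [X, ContinuousLinearMap.star_eq_adjoint, map_add, map_sub,
      ContinuousLinearMap.adjoint_comp, T', ContinuousLinearMap.adjoint_adjoint]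
    rw [← ContinuousLinearMap.star_eq_adjoint (1 : F →L[𝕜] F), star_one,
      ContinuousLinearMap.comp_assoc]
  have hmul : ∀ w w' : G →L[𝕜] G, w * w' = 1 → X w * X w' = 1 := fun w w' h => by
    ext x
    have h1 : T' (X w' x) = w' (T' x) := by simp [X, hT]
    have h2 : w (w' (T' x)) = T' x := congrArg (fun f : G →L[𝕜] G => f (T' x)) h
    have h3 : X w (X w' x) = T (w (T' (X w' x))) + (X w' x - T (T' (X w' x))) := rfl
    have h4 : X w' x = T (w' (T' x)) + (x - T (T' x)) := rfl
    rw [mul_apply_eq_comp, h3, h1, h2, h4, one_apply_eq_self]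
    abel
  exact ⟨X v, by
    rw [Unitary.mem_iff, hstar]
    exact ⟨hmul _ _ (Unitary.mem_iff.1 v.2).1, hmul _ _ (Unitary.mem_iff.1 v.2).2⟩⟩

section

variable {F G : Type*} [NormedAddCommGroup F] [InnerProductSpace 𝕜 F] [CompleteSpace F]
    [NormedAddCommGroup G] [InnerProductSpace 𝕜 G] [CompleteSpace G] (A : G →ₗᵢ[𝕜] F)

theorem coe_extendAlong (v : unitary (G →L[𝕜] G)) :
    (extendAlong A v : F →L[𝕜] F) =
      A.toContinuousLinearMap ∘L (v : G →L[𝕜] G) ∘L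
        ContinuousLinearMap.adjoint A.toContinuousLinearMap +
      (1 - A.toContinuousLinearMap ∘L ContinuousLinearMap.adjoint A.toContinuousLinearMap) := rfl

theorem extendAlong_apply (v : unitary (G →L[𝕜] G)) (y : G) :
    (extendAlong A v : F →L[𝕜] F) (A y) = A ((v : G →L[𝕜] G) y) := by
  have hT : ContinuousLinearMap.adjoint A.toContinuousLinearMap (A y) = y := by
    have := (ContinuousLinearMap.norm_map_iff_adjoint_comp_self A.toContinuousLinearMap).1
      A.norm_map
    exact congrArg (fun f : G →L[𝕜] G => f y) this
  rw [coe_extendAlong]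
  simp [hT]

theorem continuous_extendAlong : Continuous (extendAlong A) := by
  refine continuous_induced_rng.2 ?_
  change Continuous fun v => (extendAlong A v : F →L[𝕜] F)
  simp only [coe_extendAlong]
  exact (continuous_const.clm_comp (continuous_subtype_val.clm_comp continuous_const)).add
    continuous_const

end

variable {α : Type*} [Fintype α]

/-- The inclusion of a coordinate subspace. -/
def coordInclusion (𝕜 : Type*) [RCLike 𝕜] {α : Type*} [Fintype α] (J : Finset α) :
    EuclideanSpace 𝕜 J →ₗᵢ[𝕜] EuclideanSpace 𝕜 α :=
  ((EuclideanSpace.basisFun J 𝕜).toBasis.constr 𝕜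
    fun j : J => EuclideanSpace.basisFun α 𝕜 (j : α)).isometryOfOrthonormal
    (v := (EuclideanSpace.basisFun J 𝕜).toBasis)
    (by simp)
    (by
      have : ⇑((EuclideanSpace.basisFun J 𝕜).toBasis.constr 𝕜
          fun j : J => EuclideanSpace.basisFun α 𝕜 (j : α)) ∘
          (EuclideanSpace.basisFun J 𝕜).toBasis =
          EuclideanSpace.basisFun α 𝕜 ∘ Subtype.val := by
        funext j
        exact Module.Basis.constr_basis _ _ _ _
      rw [this]
      exact (EuclideanSpace.basisFun α 𝕜).orthonormal.comp _ Subtype.val_injective)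

theorem coordInclusion_basisFun (J : Finset α) (j : J) :
    coordInclusion 𝕜 J (EuclideanSpace.basisFun J 𝕜 j) = EuclideanSpace.basisFun α 𝕜 (j : α) := by
  have := Module.Basis.constr_basis (EuclideanSpace.basisFun J 𝕜).toBasis 𝕜
    (fun j : J => EuclideanSpace.basisFun α 𝕜 (j : α)) j
  rwa [OrthonormalBasis.coe_toBasis] at this

/-- The extension of an isometry of `𝕜^J` to `𝕜^α` by the identity on the other coordinates. -/
def blockExtend {J : Finset α} (v : UnitaryGrp 𝕜 J) : UnitaryGrp 𝕜 α :=
  extendAlong (coordInclusion 𝕜 J) v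

theorem continuous_blockExtend {J : Finset α} :
    Continuous (blockExtend : UnitaryGrp 𝕜 J → UnitaryGrp 𝕜 α) :=
  continuous_extendAlong _

variable {E : Type*} [NormedAddCommGroup E] [InnerProductSpace 𝕜 E]

/-- Rotating inside the subspace spanned by part of a rotated frame is the same as right
multiplication of the ambient rotation by a block isometry. -/
theorem coe_rotate_blockExtend {V W : Submodule 𝕜 E} (b : OrthonormalBasis α 𝕜 V)
    (u : UnitaryGrp 𝕜 α) {J : Finset α} (c : OrthonormalBasis J 𝕜 W)
    (hc : ∀ j, (c j : E) = rotate b u j) (v : UnitaryGrp 𝕜 J) (j : J) :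
    (rotate c v j : E) = rotate b (u * blockExtend v) j := by
  classical
  have h : W.subtype ∘ₗ (c.repr.symm.toLinearEquiv : EuclideanSpace 𝕜 J →ₗ[𝕜] W) =
      V.subtype ∘ₗ (b.repr.symm.toLinearEquiv : EuclideanSpace 𝕜 α →ₗ[𝕜] V) ∘ₗ
        ((u : EuclideanSpace 𝕜 α →L[𝕜] EuclideanSpace 𝕜 α) :
          EuclideanSpace 𝕜 α →ₗ[𝕜] EuclideanSpace 𝕜 α) ∘ₗ (coordInclusion 𝕜 J).toLinearMap := by
    refine (EuclideanSpace.basisFun J 𝕜).toBasis.ext fun i => ?_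
    rw [OrthonormalBasis.coe_toBasis]
    change (c.repr.symm (EuclideanSpace.basisFun J 𝕜 i) : E) =
      (b.repr.symm ((u : EuclideanSpace 𝕜 α →L[𝕜] EuclideanSpace 𝕜 α)
        (coordInclusion 𝕜 J (EuclideanSpace.basisFun J 𝕜 i))) : E)
    rw [coordInclusion_basisFun, ← rotate_apply, ← hc, EuclideanSpace.basisFun_apply,
      c.repr_symm_single]
  have h' := LinearMap.congr_fun h ((v : EuclideanSpace 𝕜 J →L[𝕜] EuclideanSpace 𝕜 J)
    (EuclideanSpace.basisFun J 𝕜 j))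
  refine h'.trans ?_
  change (b.repr.symm ((u : EuclideanSpace 𝕜 α →L[𝕜] EuclideanSpace 𝕜 α)
    (coordInclusion 𝕜 J _)) : E) = (b.repr.symm ((u : EuclideanSpace 𝕜 α →L[𝕜] _)
      ((blockExtend v : EuclideanSpace 𝕜 α →L[𝕜] _) (EuclideanSpace.basisFun α 𝕜 j))) : E)
  rw [← coordInclusion_basisFun J j, blockExtend, extendAlong_apply]

theorem exists_orthonormalBasis_of_eq_span {ι : Type*} {c : ι → E} (hc : Orthonormal 𝕜 c)
    (J : Finset ι) {W : Submodule 𝕜 E} (hW : W = Submodule.span 𝕜 (c '' J)) :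
    ∃ b : OrthonormalBasis J 𝕜 W, ∀ j, (b j : E) = c j := by
  classical
  rw [← Finset.coe_image] at hW
  subst hW
  exact ⟨OrthonormalBasis.span hc J, fun j => OrthonormalBasis.span_apply hc J j⟩

end Block

/-! ### Random flags of adapted subspaces. -/

namespace Splitting

variable {𝕜 : Type*} [RCLike 𝕜] {E : Type*} [NormedAddCommGroup E] [InnerProductSpace 𝕜 E]
  {σ : Splitting 𝕜 E} {α : Fin σ.s → Type*} [∀ i, Fintype (α i)]

/-- The adapted subspace spanned by the vectors with index in `J` of the rotated basis. -/
def flat (e : ∀ i, OrthonormalBasis (α i) 𝕜 (σ.V i)) (J : ∀ i, Finset (α i))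
    (u : ∀ i, UnitaryGrp 𝕜 (α i)) : σ.Gr :=
  σ.frameSum (fun _ => le_rfl) (fun i => rotate (e i) (u i)) J

/-- A family of subsets of `J i`, seen as subsets of `α i`. -/
def liftFinset {J : ∀ i, Finset (α i)} (I : ∀ i, Finset (J i)) (i : Fin σ.s) : Finset (α i) :=
  (I i).map (Function.Embedding.subtype _)

/-- The extension by the identity of isometries of coordinate subspaces. -/
def blockExtendPi {J : ∀ i, Finset (α i)} (v : ∀ i, UnitaryGrp 𝕜 (J i)) (i : Fin σ.s) :
    UnitaryGrp 𝕜 (α i) :=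
  blockExtend (v i)

section

variable (e : ∀ i, OrthonormalBasis (α i) 𝕜 (σ.V i)) (J : ∀ i, Finset (α i))
    (u : ∀ i, UnitaryGrp 𝕜 (α i))

theorem exists_basis_flat_inf : ∃ c : ∀ i, OrthonormalBasis (J i) 𝕜
    ((flat e J u).1 ⊓ σ.V i : Submodule 𝕜 E), ∀ i j, (c i j : E) = rotate (e i) (u i) j := by
  have : ∀ i, ∃ c : OrthonormalBasis (J i) 𝕜 ((flat e J u).1 ⊓ σ.V i : Submodule 𝕜 E),
      ∀ j, (c j : E) = rotate (e i) (u i) j := fun i =>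
    exists_orthonormalBasis_of_eq_span
      ((rotate (e i) (u i)).orthonormal.comp_linearIsometry (σ.V i).subtypeₗᵢ) (J i)
      (frameSum_inf J i)
  choose c hc using this
  exact ⟨c, hc⟩

theorem frameSum_rotate_eq_flat {c : ∀ i, OrthonormalBasis (J i) 𝕜
    ((flat e J u).1 ⊓ σ.V i : Submodule 𝕜 E)} (hc : ∀ i j, (c i j : E) = rotate (e i) (u i) j)
    (I : ∀ i, Finset (J i)) (v : ∀ i, UnitaryGrp 𝕜 (J i)) :
    σ.frameSum (fun _ => inf_le_right) (fun i => rotate (c i) (v i)) I =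
      flat e (liftFinset I) (u * blockExtendPi v) := by
  apply Subtype.ext
  refine (coe_frameSum _).trans (Eq.trans ?_ (coe_frameSum _).symm)
  congr 1
  funext i
  congr 1
  rw [liftFinset, Finset.coe_map, ← Set.image_comp]
  exact Set.image_congr fun j _ => coe_rotate_blockExtend (e i) (u i) (c i) (hc i) (v i) j

/-- The block isometries only mix the vectors that already span the flat. -/
theorem flat_mul_blockExtendPi (v : ∀ i, UnitaryGrp 𝕜 (J i)) :
    flat e J (u * blockExtendPi v) = flat e J u := by
  obtain ⟨c, hc⟩ := exists_basis_flat_inf e J u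
  have h := frameSum_rotate_eq_flat e J u hc (fun _ => Finset.univ) v
  have hJ : liftFinset (fun i => (Finset.univ : Finset (J i))) = J := by
    funext i
    ext x
    simp [liftFinset]
  rw [hJ] at h
  rw [← h]
  apply Subtype.ext
  rw [coe_frameSum_univ]
  exact (flat e J u).2.symm

theorem measurable_mul_blockExtendPi : Measurable fun p : (∀ i, UnitaryGrp 𝕜 (α i)) ×
    (∀ i, UnitaryGrp 𝕜 (J i)) => p.1 * blockExtendPi p.2 := by
  refine measurable_pi_lambda _ fun i => ?_
  have h : Measurable fun q : UnitaryGrp 𝕜 (α i) × UnitaryGrp 𝕜 (J i) =>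
      q.1 * blockExtend q.2 :=
    (continuous_fst.mul (continuous_blockExtend.comp continuous_snd)).measurable
  have h2 : Measurable fun p : (∀ i, UnitaryGrp 𝕜 (α i)) × (∀ i, UnitaryGrp 𝕜 (J i)) =>
      (p.1 i, p.2 i) :=
    ((measurable_pi_apply i).comp measurable_fst).prodMk
      ((measurable_pi_apply i).comp measurable_snd)
  exact h.comp h2

variable [FiniteDimensional 𝕜 E]

theorem measurable_flat : Measurable (flat e J) :=
  (continuous_frameSum_rotate (fun _ => le_rfl) e J).measurable

theorem nuSub_flat_apply {B : Set σ.Gr} (hB : MeasurableSet B) :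
    σ.nuSub (flat e J u) B = ∑ I : ∀ i, Finset (J i), haarPi 𝕜 (fun i => J i)
      {v | flat e (liftFinset I) (u * blockExtendPi v) ∈ B} := by
  obtain ⟨c, hc⟩ := exists_basis_flat_inf e J u
  rw [nuSub, splitMeasure_eq_sum _ c, Measure.coe_finsetSum, Finset.sum_apply]
  refine Finset.sum_congr rfl fun I _ => ?_
  rw [Measure.map_apply (continuous_frameSum_rotate (fun _ => inf_le_right) c I).measurable hB]
  congr 1
  ext v
  rw [Set.mem_preimage, frameSum_rotate_eq_flat e J u hc]
  rfl

end

open scoped Classical in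
theorem sum_liftFinset (J : ∀ i, Finset (α i)) (F : (∀ i, Finset (α i)) → ℝ≥0∞) :
    ∑ I : ∀ i, Finset (J i), F (liftFinset I) =
      ∑ I : ∀ i, Finset (α i) with ∀ i, I i ⊆ J i, F I := by
  refine Finset.sum_nbij' (fun I => liftFinset I)
    (fun I i => (I i).subtype (· ∈ J i)) ?_ ?_ ?_ ?_ ?_
  · intro I _
    simp only [Finset.mem_filter, Finset.mem_univ, true_and]
    intro i x hx
    obtain ⟨y, _, rfl⟩ := Finset.mem_map.1 hx
    exact y.2
  · intro I _
    exact Finset.mem_univ _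
  · intro I _
    funext i
    ext x
    simp [liftFinset]
  · intro I hI
    funext i
    ext x
    have := (Finset.mem_filter.1 hI).2 i
    simp only [liftFinset, Finset.mem_map, Finset.mem_subtype, Function.Embedding.subtype_apply]
    exact ⟨fun ⟨y, hy, hyx⟩ => hyx ▸ hy, fun hx => ⟨⟨x, this hx⟩, hx, rfl⟩⟩
  · intro I _
    rfl

variable [FiniteDimensional 𝕜 E] (e : ∀ i, OrthonormalBasis (α i) 𝕜 (σ.V i))

theorem measurableSet_flat_mul {B : Set σ.Gr} (hB : MeasurableSet B) (J : ∀ i, Finset (α i))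
    (I : ∀ i, Finset (J i)) :
    MeasurableSet {p : (∀ i, UnitaryGrp 𝕜 (α i)) × (∀ i, UnitaryGrp 𝕜 (J i)) |
      flat e (liftFinset I) (p.1 * blockExtendPi p.2) ∈ B} :=
  ((measurable_flat e _).comp (measurable_mul_blockExtendPi J)) hB

theorem exists_flat_eq (Q : σ.Gr) : ∃ (J : ∀ i, Finset (α i)) (u : ∀ i, UnitaryGrp 𝕜 (α i)),
    flat e J u = Q := by
  have := fun i => exists_span_image_eq (e i) (Q.1.comap (σ.V i).subtype)
  choose J u h using this
  refine ⟨J, u, Subtype.ext ?_⟩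
  have hQ : Q.1 = ⨆ i, Q.1 ⊓ σ.V i := Q.2
  simp only [flat, frameSum, directSum, h, Submodule.map_comap_subtype]
  simp only [inf_comm (σ.V _)]
  exact hQ.symm

/-- Measurability on the split Grassmannian can be tested along the maps `flat e J`. -/
theorem measurable_of_measurable_comp_flat {β : Type*} [MeasurableSpace β] {f : σ.Gr → β}
    (hf : ∀ J, Measurable fun u => f (flat e J u)) : Measurable f := by
  let : MeasurableSpace (∀ i, Finset (α i)) := ⊤
  have : DiscreteMeasurableSpace (∀ i, Finset (α i)) := ⟨fun _ => trivial⟩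
  let Φ : (∀ i, Finset (α i)) × (∀ i, UnitaryGrp 𝕜 (α i)) → σ.Gr := fun p => flat e p.1 p.2
  have hΦ : Measurable Φ := measurable_from_prod_countable_right fun J => measurable_flat e J
  have hsurj : Function.Surjective Φ := fun Q => by
    obtain ⟨J, u, h⟩ := exists_flat_eq e Q
    exact ⟨(J, u), h⟩
  have hs : ∀ i, StandardBorelSpace (UnitaryGrp 𝕜 (α i)) := fun i => inferInstance
  -- A measurable surjection from a standard Borel space onto this Grassmannian detects
  -- measurability, by the theory of analytic sets. No measurable choice of frames is needed.
  rw [← hΦ.measurable_comp_iff_of_surjective hsurj]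
  exact measurable_from_prod_countable_right hf

variable (σ) in
-- The spaces Q ∩ E_i vary with Q, but along a flat the measure is an explicit parametric Haar
-- integral in u.
theorem measurable_nuSub : Measurable σ.nuSub := by
  refine Measure.measurable_of_measurable_coe _ fun B hB => ?_
  refine measurable_of_measurable_comp_flat (fun i => stdOrthonormalBasis 𝕜 (σ.V i)) fun J => ?_
  simp only [nuSub_flat_apply _ J _ hB]
  exact Finset.measurable_fun_sum _ fun I _ =>
    measurable_measure_prodMk_left (measurableSet_flat_mul _ hB J I)

variable (σ) in
theorem measurable_finrank : Measurable fun Q : σ.Gr => Module.finrank 𝕜 Q.1 := by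
  refine measurable_of_measurable_comp_flat (fun i => stdOrthonormalBasis 𝕜 (σ.V i)) fun J => ?_
  have : ∀ u, Module.finrank 𝕜 (flat (fun i => stdOrthonormalBasis 𝕜 (σ.V i)) J u).1 =
      ∑ i, (J i).card := fun u => finrank_frameSum J
  simp only [this]
  exact measurable_const

theorem lintegral_nu {g : σ.Gr → ℝ≥0∞} (hg : Measurable g) :
    ∫⁻ Q, g Q ∂σ.nu = ∑ J : ∀ i, Finset (α i), ∫⁻ u, g (flat e J u) ∂haarPi 𝕜 α := by
  rw [nu, splitMeasure_eq_sum _ e, lintegral_finsetSum_measure]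
  exact Finset.sum_congr rfl fun J _ => lintegral_map hg (measurable_flat e J)

theorem lintegral_flat_mul_nuSub {g : σ.Gr → ℝ≥0∞} (hg : Measurable g) {B : Set σ.Gr}
    (hB : MeasurableSet B) (J : ∀ i, Finset (α i)) :
    ∫⁻ u, g (flat e J u) * σ.nuSub (flat e J u) B ∂haarPi 𝕜 α =
      ∑ I : ∀ i, Finset (J i), ∫⁻ u, g (flat e J u) *
        B.indicator 1 (flat e (liftFinset I) u) ∂haarPi 𝕜 α := by
  simp only [nuSub_flat_apply e J _ hB, Finset.mul_sum]
  have hm : ∀ I : ∀ i, Finset (J i), Measurable fun u => g (flat e J u) *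
      haarPi 𝕜 (fun i => J i) {v | flat e (liftFinset I) (u * blockExtendPi v) ∈ B} := fun I =>
    (hg.comp (measurable_flat e J)).mul
      (measurable_measure_prodMk_left (measurableSet_flat_mul e hB J I))
  rw [lintegral_finsetSum _ fun I _ => hm I]
  refine Finset.sum_congr rfl fun I _ => ?_
  let h : (∀ i, UnitaryGrp 𝕜 (α i)) → ℝ≥0∞ := fun u =>
    g (flat e J u) * B.indicator 1 (flat e (liftFinset I) u)
  have hh : Measurable h := (hg.comp (measurable_flat e J)).mul
    ((measurable_one.indicator hB).comp (measurable_flat e _))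
  have h1 : ∀ u, g (flat e J u) * haarPi 𝕜 (fun i => J i)
      {v | flat e (liftFinset I) (u * blockExtendPi v) ∈ B} =
      ∫⁻ v, h (u * blockExtendPi v) ∂haarPi 𝕜 fun i => J i := by
    intro u
    -- By invariance of the larger flat, g may be evaluated at u or at u times the block isometry,
    -- so both factors become one function of that product.
    simp only [h, flat_mul_blockExtendPi]
    have hs : MeasurableSet {v : ∀ i, UnitaryGrp 𝕜 (J i) |
        flat e (liftFinset I) (u * blockExtendPi v) ∈ B} :=
      measurable_prodMk_left (measurableSet_flat_mul e hB J I)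
    have hi : ∀ v : ∀ i, UnitaryGrp 𝕜 (J i), B.indicator (1 : σ.Gr → ℝ≥0∞)
        (flat e (liftFinset I) (u * blockExtendPi v)) =
        {v : ∀ i, UnitaryGrp 𝕜 (J i) |
          flat e (liftFinset I) (u * blockExtendPi v) ∈ B}.indicator 1 v := fun v => rfl
    simp only [hi]
    rw [lintegral_const_mul _ (measurable_one.indicator hs), lintegral_indicator_one hs]
  simp only [h1]
  have h3 : Measurable (Function.uncurry fun (u : ∀ i, UnitaryGrp 𝕜 (α i))
      (v : ∀ i, UnitaryGrp 𝕜 (J i)) => h (u * blockExtendPi v)) :=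
    hh.comp (measurable_mul_blockExtendPi J)
  rw [lintegral_lintegral_swap h3.aemeasurable]
  -- Once u is integrated first, right invariance of Haar measure makes the inner integral
  -- independent of v.
  have h2 : ∀ v : ∀ i, UnitaryGrp 𝕜 (J i),
      ∫⁻ u, h (u * blockExtendPi v) ∂haarPi 𝕜 α = ∫⁻ u, h u ∂haarPi 𝕜 α := fun v =>
    lintegral_mul_right_eq_self h _
  simp only [h2, lintegral_const, measure_univ, mul_one]
  rfl

open scoped Classical in
/-- The law of a random flag can be sampled from its smallest or from its largest subspace. -/
theorem lintegral_mul_nuSub {g : σ.Gr → ℝ≥0∞} (hg : Measurable g) {B : Set σ.Gr}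
    (hB : MeasurableSet B) :
    ∫⁻ Q, g Q * σ.nuSub Q B ∂σ.nu =
      ∑ I : ∀ i, Finset (α i), ∫⁻ u, (∑ J : ∀ i, Finset (α i) with ∀ i, I i ⊆ J i,
        g (flat e J u)) * B.indicator 1 (flat e I u) ∂haarPi 𝕜 α := by
  have hn : Measurable fun Q => σ.nuSub Q B := (Measure.measurable_coe hB).comp σ.measurable_nuSub
  rw [lintegral_nu e (g := fun Q => g Q * σ.nuSub Q B) (hg.mul hn)]
  simp only [lintegral_flat_mul_nuSub e hg hB, Finset.sum_mul]
  simp only [fun J : ∀ i, Finset (α i) => sum_liftFinset J fun I => ∫⁻ u, g (flat e J u) *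
        B.indicator 1 (flat e I u) ∂haarPi 𝕜 α]
  have hm : ∀ I J : ∀ i, Finset (α i), Measurable fun u => g (flat e J u) *
      B.indicator (1 : σ.Gr → ℝ≥0∞) (flat e I u) := fun I J =>
    (hg.comp (measurable_flat e J)).mul ((measurable_one.indicator hB).comp (measurable_flat e _))
  simp only [fun I : ∀ i, Finset (α i) => lintegral_finsetSum
    (Finset.univ.filter fun J : ∀ i, Finset (α i) => ∀ i, I i ⊆ J i)
    (μ := haarPi 𝕜 α) fun J _ => hm I J]
  simp only [Finset.sum_filter]
  rw [Finset.sum_comm]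

end Splitting

/-! ### Injectivity of the incidence map. -/

namespace Splitting

variable {𝕜 : Type*} [RCLike 𝕜] {E : Type*} [NormedAddCommGroup E] [InnerProductSpace 𝕜 E]
  {σ : Splitting 𝕜 E}

theorem frameSum_univ_eq {α : Fin σ.s → Type*} [∀ i, Fintype (α i)] (Q : σ.Gr)
    (b : ∀ i, OrthonormalBasis (α i) 𝕜 (Q.1 ⊓ σ.V i : Submodule 𝕜 E)) :
    σ.frameSum (fun _ => inf_le_right) b (fun _ => Finset.univ) = Q :=
  Subtype.ext (coe_frameSum_univ.trans Q.2.symm)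

variable [FiniteDimensional 𝕜 E]

theorem nuSub_apply {α : Fin σ.s → Type*} [∀ i, Fintype (α i)] (Q : σ.Gr)
    (b : ∀ i, OrthonormalBasis (α i) 𝕜 (Q.1 ⊓ σ.V i : Submodule 𝕜 E)) {B : Set σ.Gr}
    (hB : MeasurableSet B) :
    σ.nuSub Q B = ∑ I : ∀ i, Finset (α i), haarPi 𝕜 α
      {v | σ.frameSum (fun _ => inf_le_right) (fun i => rotate (b i) (v i)) I ∈ B} := by
  rw [nuSub, splitMeasure_eq_sum _ b, Measure.coe_finsetSum, Finset.sum_apply]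
  exact Finset.sum_congr rfl fun I _ =>
    Measure.map_apply (continuous_frameSum_rotate (fun _ => inf_le_right) b I).measurable hB

/-- Diagonal blocks of the triangular system: only the full family of indices can span a subspace of
dimension as large as dim Q, and it always spans Q itself. -/
theorem nuSub_inter_finrank (Q : σ.Gr) {B : Set σ.Gr} (hB : MeasurableSet B) {N : ℕ}
    (hQ : Module.finrank 𝕜 Q.1 ≤ N) :
    σ.nuSub Q (B ∩ {R | Module.finrank 𝕜 R.1 = N}) =
      (B ∩ {R | Module.finrank 𝕜 R.1 = N}).indicator 1 Q := by
  let b := fun i => stdOrthonormalBasis 𝕜 (Q.1 ⊓ σ.V i : Submodule 𝕜 E)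
  have hT : MeasurableSet {R : σ.Gr | Module.finrank 𝕜 R.1 = N} :=
    σ.measurable_finrank (measurableSet_singleton N)
  have hdim : Module.finrank 𝕜 Q.1 =
      ∑ i, (Finset.univ : Finset (Fin (Module.finrank 𝕜 (Q.1 ⊓ σ.V i : Submodule 𝕜 E)))).card := by
    conv_lhs => rw [← frameSum_univ_eq Q b]
    exact finrank_frameSum _
  rw [nuSub_apply Q b (hB.inter hT), Finset.sum_eq_single fun _ => Finset.univ]
  · simp only [frameSum_univ_eq]
    by_cases h : Q ∈ B ∩ {R | Module.finrank 𝕜 R.1 = N}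
    · simp [h]
    · simp [h]
  · intro I _ hI
    have hlt : ∑ i, (I i).card < Module.finrank 𝕜 Q.1 := by
      rw [hdim]
      obtain ⟨i, hi⟩ := Function.ne_iff.1 hI
      exact Finset.sum_lt_sum (fun j _ => Finset.card_le_card (Finset.subset_univ _))
        ⟨i, Finset.mem_univ _, Finset.card_lt_card (Finset.ssubset_univ_iff.2 hi)⟩
    suffices hs : {v : ∀ i, UnitaryGrp 𝕜
        (Fin (Module.finrank 𝕜 (Q.1 ⊓ σ.V i : Submodule 𝕜 E))) |
        σ.frameSum (fun _ => inf_le_right) (fun i => rotate (b i) (v i)) I ∈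
        B ∩ {R | Module.finrank 𝕜 R.1 = N}} = ∅ by rw [hs, measure_empty]
    rw [Set.eq_empty_iff_forall_notMem]
    rintro v ⟨-, hv⟩
    have hv' : Module.finrank 𝕜 (σ.frameSum (fun _ => inf_le_right)
      (fun i => rotate (b i) (v i)) I).1 = N := hv
    rw [finrank_frameSum] at hv'
    omega
  · exact fun h => absurd (Finset.mem_univ _) h

/-- The mass is the number 2^{dim Q} of families of coordinate subsets. The uniform bound makes the
off-diagonal terms finite, so that they can be cancelled. -/
theorem nuSub_univ_le (Q : σ.Gr) : σ.nuSub Q Set.univ ≤ 2 ^ Module.finrank 𝕜 E := by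
  let b := fun i => stdOrthonormalBasis 𝕜 (Q.1 ⊓ σ.V i : Submodule 𝕜 E)
  have hdim : Module.finrank 𝕜 Q.1 = ∑ i, Module.finrank 𝕜 (Q.1 ⊓ σ.V i : Submodule 𝕜 E) := by
    conv_lhs => rw [← frameSum_univ_eq Q b]
    refine (finrank_frameSum _).trans ?_
    simp
  rw [nuSub_apply Q b MeasurableSet.univ]
  simp only [Set.mem_univ, Set.ofPred_true, measure_univ, Finset.sum_const, Finset.card_univ,
    Fintype.card_pi, Fintype.card_finset, Fintype.card_fin, Finset.prod_pow_eq_pow_sum, ← hdim]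
  simp only [nsmul_eq_mul, mul_one, Nat.cast_pow, Nat.cast_ofNat]
  exact pow_le_pow_right₀ (by norm_num) Q.1.finrank_le

/-- Only the empty family contributes. Hence the incidence measure of the zero subspace is the total
mass of the original measure. -/
theorem nuSub_finrank_eq_zero (Q : σ.Gr) : σ.nuSub Q {R | Module.finrank 𝕜 R.1 = 0} = 1 := by
  let b := fun i => stdOrthonormalBasis 𝕜 (Q.1 ⊓ σ.V i : Submodule 𝕜 E)
  have hT : MeasurableSet {R : σ.Gr | Module.finrank 𝕜 R.1 = 0} :=
    σ.measurable_finrank (measurableSet_singleton 0)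
  rw [nuSub_apply Q b hT]
  simp only [Set.mem_ofPred_eq, finrank_frameSum]
  rw [Finset.sum_eq_single fun _ => ∅]
  · simp
  · intro I _ hI
    obtain ⟨i, hi⟩ := Function.ne_iff.1 hI
    have : ¬ ∑ i, (I i).card = 0 := by
      rw [Finset.sum_eq_zero_iff]
      exact fun h => hi (Finset.card_eq_zero.1 (h i (Finset.mem_univ _)))
    simp [this]
  · exact fun h => absurd (Finset.mem_univ _) h

theorem nu_finrank_eq_zero : σ.nu {R | Module.finrank 𝕜 R.1 = 0} = 1 := by
  have h : σ.nuSub ⟨⊤, by simpa [IsAdapted] using σ.iSup_eq_top.symm⟩ = σ.nu := by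
    simp [nuSub, nu]
  rw [← h, nuSub_finrank_eq_zero]

theorem incidence_apply (μ : Measure σ.Gr) {B : Set σ.Gr} (hB : MeasurableSet B) :
    σ.incidence μ B = ∫⁻ Q, σ.nuSub Q B ∂μ :=
  Measure.bind_apply hB σ.measurable_nuSub.aemeasurable

theorem incidence_inter_finrank (μ : Measure σ.Gr) {B : Set σ.Gr} (hB : MeasurableSet B) (N : ℕ) :
    σ.incidence μ (B ∩ {R | Module.finrank 𝕜 R.1 = N}) =
      ∫⁻ Q in {R | N < Module.finrank 𝕜 R.1},
        σ.nuSub Q (B ∩ {R | Module.finrank 𝕜 R.1 = N}) ∂μ +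
      μ (B ∩ {R | Module.finrank 𝕜 R.1 = N}) := by
  have hT : MeasurableSet {R : σ.Gr | Module.finrank 𝕜 R.1 = N} :=
    σ.measurable_finrank (measurableSet_singleton N)
  have hA : MeasurableSet {R : σ.Gr | N < Module.finrank 𝕜 R.1} :=
    σ.measurable_finrank measurableSet_Ioi
  rw [incidence_apply μ (hB.inter hT), ← lintegral_add_compl _ hA]
  congr 1
  rw [setLIntegral_congr_fun hA.compl
    (g := (B ∩ {R | Module.finrank 𝕜 R.1 = N}).indicator 1)
    fun Q hQ => nuSub_inter_finrank Q hB (not_lt.1 hQ),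
    lintegral_indicator_one (hB.inter hT), Measure.restrict_apply (hB.inter hT)]
  congr 1
  ext Q
  constructor
  · exact fun h => h.1
  · intro h
    refine ⟨h, ?_⟩
    have : Module.finrank 𝕜 Q.1 = N := h.2
    simp [this]

/-- Descending induction on the dimension, with m counting the dimensions already treated: the
strict inequality makes the set empty at m = 0 and everything at m = dim E + 1. -/
theorem restrict_finrank_eq_of_incidence_eq {μ μ' : Measure σ.Gr} [IsFiniteMeasure μ]
    [IsFiniteMeasure μ'] (h : σ.incidence μ = σ.incidence μ') (m : ℕ) :
    μ.restrict {R | Module.finrank 𝕜 E < Module.finrank 𝕜 R.1 + m} =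
      μ'.restrict {R | Module.finrank 𝕜 E < Module.finrank 𝕜 R.1 + m} := by
  induction m with
  | zero =>
    have : {R : σ.Gr | Module.finrank 𝕜 E < Module.finrank 𝕜 R.1 + 0} = ∅ := by
      ext R
      simpa using R.1.finrank_le
    rw [this, Measure.restrict_empty, Measure.restrict_empty]
  | succ m ih =>
    by_cases hm : Module.finrank 𝕜 E < m
    · have : {R : σ.Gr | Module.finrank 𝕜 E < Module.finrank 𝕜 R.1 + (m + 1)} =
          {R : σ.Gr | Module.finrank 𝕜 E < Module.finrank 𝕜 R.1 + m} := by
        ext R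
        simp only [Set.mem_ofPred_eq]
        omega
      rw [this, ih]
    -- N = dim E - m is the dimension added at this step.
    obtain ⟨N, hN⟩ := Nat.exists_eq_add_of_le (not_lt.1 hm)
    have hT : MeasurableSet {R : σ.Gr | Module.finrank 𝕜 R.1 = N} :=
      σ.measurable_finrank (measurableSet_singleton N)
    have hA : MeasurableSet {R : σ.Gr | N < Module.finrank 𝕜 R.1} :=
      σ.measurable_finrank measurableSet_Ioi
    have h1 : {R : σ.Gr | Module.finrank 𝕜 E < Module.finrank 𝕜 R.1 + m} =
        {R | N < Module.finrank 𝕜 R.1} := by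
      ext R; simp only [Set.mem_ofPred_eq]; omega
    have h2 : {R : σ.Gr | Module.finrank 𝕜 E < Module.finrank 𝕜 R.1 + (m + 1)} =
        {R | N < Module.finrank 𝕜 R.1} ∪ {R | Module.finrank 𝕜 R.1 = N} := by
      ext R; simp only [Set.mem_ofPred_eq, Set.mem_union]; omega
    rw [h1] at ih
    have hdisj : Disjoint {R : σ.Gr | N < Module.finrank 𝕜 R.1}
        {R | Module.finrank 𝕜 R.1 = N} := by
      rw [Set.disjoint_left]
      intro R hR hR'
      simp only [Set.mem_ofPred_eq] at hR hR'
      omega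
    have h3 : μ.restrict {R | Module.finrank 𝕜 R.1 = N} =
        μ'.restrict {R | Module.finrank 𝕜 R.1 = N} := by
      ext B hB
      rw [Measure.restrict_apply hB, Measure.restrict_apply hB]
      have e := incidence_inter_finrank μ hB N
      rw [h, incidence_inter_finrank μ' hB N, ih] at e
      refine ((ENNReal.add_right_inj ?_).1 e).symm
      refine (lt_of_le_of_lt (lintegral_mono fun Q =>
        (measure_mono (Set.subset_univ _)).trans (nuSub_univ_le Q)) ?_).ne
      rw [lintegral_const]
      exact ENNReal.mul_lt_top (ENNReal.pow_lt_top (by norm_num)) (measure_lt_top _ _)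
    rw [h2, Measure.restrict_union hdisj hT, Measure.restrict_union hdisj hT, ih, h3]

/-- A finite measure is determined by its incidence measure. -/
theorem eq_of_incidence_eq {μ μ' : Measure σ.Gr} [IsFiniteMeasure μ]
    [IsFiniteMeasure μ'] (h : σ.incidence μ = σ.incidence μ') : μ = μ' := by
  have := restrict_finrank_eq_of_incidence_eq h (Module.finrank 𝕜 E + 1)
  have hu : {R : σ.Gr | Module.finrank 𝕜 E < Module.finrank 𝕜 R.1 + (Module.finrank 𝕜 E + 1)} =
      Set.univ := by
    ext R
    simp only [Set.mem_ofPred_eq, Set.mem_univ, iff_true]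
    omega
  rwa [hu, Measure.restrict_univ, Measure.restrict_univ] at this

variable {α : Fin σ.s → Type*} [∀ i, Fintype (α i)]

/-- The basis depends on `u` but not on `J`, so the determinants of all flats with the same `u` can
be summed in one basis. -/
theorem exists_orthonormalBasis_flat (e : ∀ i, OrthonormalBasis (α i) 𝕜 (σ.V i))
    (u : ∀ i, UnitaryGrp 𝕜 (α i)) : ∃ c : OrthonormalBasis (Σ i, α i) 𝕜 E, ∀ J,
      (flat e J u).1 = Submodule.span 𝕜 (c '' (Finset.univ.sigma J)) := by
  have hV := σ.orthogonalFamily_of_le (W := σ.V) fun _ => le_rfl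
  have hint : DirectSum.IsInternal σ.V := by
    rw [hV.isInternal_iff, σ.iSup_eq_top, Submodule.top_orthogonal_eq_bot]
  refine ⟨hint.collectedOrthonormalBasis hV fun i => rotate (e i) (u i), fun J => ?_⟩
  rw [flat, coe_frameSum_eq_span]
  congr 2
  funext a
  simp [DirectSum.IsInternal.collectedOrthonormalBasis]

/-- The subsets of a sigma type, as families of subsets. -/
def finsetSigmaEquiv (α : Fin σ.s → Type*) [∀ i, Fintype (α i)] :
    (∀ i, Finset (α i)) ≃ Finset (Σ i, α i) where
  toFun J := Finset.univ.sigma J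
  invFun K := by
    classical exact fun i => Finset.univ.filter fun x => (⟨i, x⟩ : Σ i, α i) ∈ K
  left_inv J := by
    funext i; ext x; simp
  right_inv K := by
    ext ⟨i, x⟩; simp

open scoped Classical in
theorem sum_det_mixedOp_flat (k : E →ₗ[𝕜] E) (e : ∀ i, OrthonormalBasis (α i) 𝕜 (σ.V i))
    (I : ∀ i, Finset (α i)) (u : ∀ i, UnitaryGrp 𝕜 (α i)) :
    ∑ J : ∀ i, Finset (α i) with ∀ i, I i ⊆ J i, LinearMap.det (mixedOp k (flat e J u).1) =
      LinearMap.det (compression k (flat e I u).1) := by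
  obtain ⟨c, hc⟩ := exists_orthonormalBasis_flat e u
  refine Eq.trans ?_ (congrArg (fun Q => LinearMap.det (compression k Q)) (hc I)).symm
  simp only [hc]
  rw [← sum_det_mixedOp k c (Finset.univ.sigma I)]
  refine Finset.sum_equiv (finsetSigmaEquiv α) (fun J => ?_) fun J _ => rfl
  simp only [Finset.mem_filter, Finset.mem_univ, true_and, finsetSigmaEquiv, Equiv.coe_fn_mk]
  constructor
  · exact fun h => Finset.sigma_mono subset_rfl h
  · intro h i x hx
    have : (⟨i, x⟩ : Σ i, α i) ∈ Finset.univ.sigma J := h (by simpa using hx)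
    simpa using this

end Splitting

/-! ### Existence and uniqueness of the process. -/

open Splitting

variable {𝕜 : Type*} [RCLike 𝕜] {E : Type*} [NormedAddCommGroup E] [InnerProductSpace 𝕜 E]
  [FiniteDimensional 𝕜 E] {σ : Splitting 𝕜 E}

/-- The density of the determinantal linear process. -/
def processDensity (σ : Splitting 𝕜 E) (k : E →ₗ[𝕜] E) (Q : σ.Gr) : ℝ≥0 :=
  (RCLike.re (LinearMap.det (mixedOp k Q.1))).toNNReal

/-- The density of the incidence measure of the determinantal linear process. -/
def incidenceDensity (σ : Splitting 𝕜 E) (k : E →ₗ[𝕜] E) (Q : σ.Gr) : ℝ≥0 :=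
  (RCLike.re (LinearMap.det (compression k Q.1))).toNNReal

theorem measurable_processDensity (k : E →ₗ[𝕜] E) : Measurable (processDensity σ k) :=
  (continuous_real_toNNReal.comp (RCLike.continuous_re.comp
    ((continuous_det_mixedOp k).comp continuous_subtype_val))).measurable

theorem measurable_incidenceDensity (k : E →ₗ[𝕜] E) : Measurable (incidenceDensity σ k) :=
  (continuous_real_toNNReal.comp (RCLike.continuous_re.comp
    ((continuous_det_compression k).comp continuous_subtype_val))).measurable

section

variable {k : E →ₗ[𝕜] E} (hk : k.IsSymmetric) (hk0 : 0 ≤ k) (hk1 : k ≤ 1)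
include hk hk0 hk1

theorem coe_processDensity (Q : σ.Gr) :
    ((processDensity σ k Q : ℝ) : 𝕜) = LinearMap.det (mixedOp k Q.1) := by
  rw [processDensity, Real.coe_toNNReal _ (det_mixedOp_nonneg k hk hk0 hk1 Q.1),
    re_det_mixedOp k hk]

open scoped Classical in
theorem sum_processDensity {α : Fin σ.s → Type*} [∀ i, Fintype (α i)]
    (e : ∀ i, OrthonormalBasis (α i) 𝕜 (σ.V i)) (I : ∀ i, Finset (α i))
    (u : ∀ i, UnitaryGrp 𝕜 (α i)) :
    ((∑ J : ∀ i, Finset (α i) with ∀ i, I i ⊆ J i, processDensity σ k (flat e J u) : ℝ≥0) : ℝ) =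
      RCLike.re (LinearMap.det (compression k (flat e I u).1)) ∧
    (((∑ J : ∀ i, Finset (α i) with ∀ i, I i ⊆ J i,
      processDensity σ k (flat e J u) : ℝ≥0) : ℝ) : 𝕜) =
      LinearMap.det (compression k (flat e I u).1) := by
  have h : (((∑ J : ∀ i, Finset (α i) with ∀ i, I i ⊆ J i,
      processDensity σ k (flat e J u) : ℝ≥0) : ℝ) : 𝕜) =
      LinearMap.det (compression k (flat e I u).1) := by
    rw [← sum_det_mixedOp_flat, NNReal.coe_sum, RCLike.ofReal_sum]
    exact Finset.sum_congr rfl fun J _ => coe_processDensity hk hk0 hk1 _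
  exact ⟨by rw [← h, RCLike.ofReal_re], h⟩

/-- Reality and non-negativity of det k_Q^Q come from its expression as a sum of process densities
over the larger flats. -/
theorem coe_incidenceDensity (Q : σ.Gr) :
    ((incidenceDensity σ k Q : ℝ) : 𝕜) = LinearMap.det (compression k Q.1) := by
  classical
  obtain ⟨I, u, rfl⟩ := exists_flat_eq (fun i => stdOrthonormalBasis 𝕜 (σ.V i)) Q
  obtain ⟨h1, h2⟩ := sum_processDensity hk hk0 hk1 (fun i => stdOrthonormalBasis 𝕜 (σ.V i)) I u
  rw [incidenceDensity, ← h1, Real.toNNReal_coe, h2]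

open scoped Classical in
theorem sum_coe_processDensity {α : Fin σ.s → Type*} [∀ i, Fintype (α i)]
    (e : ∀ i, OrthonormalBasis (α i) 𝕜 (σ.V i)) (I : ∀ i, Finset (α i))
    (u : ∀ i, UnitaryGrp 𝕜 (α i)) :
    ∑ J : ∀ i, Finset (α i) with ∀ i, I i ⊆ J i, (processDensity σ k (flat e J u) : ℝ≥0∞) =
      incidenceDensity σ k (flat e I u) := by
  rw [incidenceDensity, ← (sum_processDensity hk hk0 hk1 e I u).1, Real.toNNReal_coe,
    ENNReal.ofNNReal_finsetSum]

theorem incidence_withDensity :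
    σ.incidence (σ.nu.withDensity fun Q => (processDensity σ k Q : ℝ≥0∞)) =
      σ.nu.withDensity fun Q => (incidenceDensity σ k Q : ℝ≥0∞) := by
  ext B hB
  let e := fun i => stdOrthonormalBasis 𝕜 (σ.V i)
  have hg : Measurable fun Q => (processDensity σ k Q : ℝ≥0∞) :=
    (measurable_processDensity k).coe_nnreal_ennreal
  have hf : Measurable fun Q => (incidenceDensity σ k Q : ℝ≥0∞) :=
    (measurable_incidenceDensity k).coe_nnreal_ennreal
  have hn : Measurable fun Q => σ.nuSub Q B := (Measure.measurable_coe hB).comp σ.measurable_nuSub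
  rw [incidence_apply _ hB, lintegral_withDensity_eq_lintegral_mul _ hg hn, withDensity_apply _ hB,
    ← lintegral_indicator hB]
  simp only [Pi.mul_apply]
  rw [lintegral_mul_nuSub e hg hB, lintegral_nu e (hf.indicator hB)]
  refine Finset.sum_congr rfl fun I _ => lintegral_congr fun u => ?_
  rw [sum_coe_processDensity hk hk0 hk1 e I u]
  by_cases hu : flat e I u ∈ B <;> simp [hu]

/-- The total mass is read off from the incidence identity evaluated at the zero subspace, where the
density and the reference mass are both 1. -/
theorem isProbabilityMeasure_withDensity :
    IsProbabilityMeasure (σ.nu.withDensity fun Q => (processDensity σ k Q : ℝ≥0∞)) := by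
  have hT : MeasurableSet {R : σ.Gr | Module.finrank 𝕜 R.1 = 0} :=
    σ.measurable_finrank (measurableSet_singleton 0)
  have h := congrArg (fun μ => μ {R : σ.Gr | Module.finrank 𝕜 R.1 = 0})
    (incidence_withDensity (σ := σ) hk hk0 hk1)
  simp only [incidence_apply _ hT, nuSub_finrank_eq_zero, lintegral_one] at h
  refine ⟨h.trans ?_⟩
  rw [withDensity_apply _ hT, setLIntegral_congr_fun hT (g := 1), Pi.one_def, lintegral_const,
    one_mul, Measure.restrict_apply_univ, nu_finrank_eq_zero]
  intro Q hQ
  have : LinearMap.det (compression k Q.1) = 1 := LinearMap.det_eq_one_of_finrank_eq_zero hQ _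
  simp [incidenceDensity, this]

theorem isDLP_withDensity :
    IsDLP σ k (σ.nu.withDensity fun Q => (processDensity σ k Q : ℝ≥0∞)) where
  isProbabilityMeasure := isProbabilityMeasure_withDensity hk hk0 hk1
  density := ⟨incidenceDensity σ k, coe_incidenceDensity hk hk0 hk1,
    incidence_withDensity hk hk0 hk1⟩

end

/-- The kernel fixes the density, hence the incidence measure, which determines a finite measure. -/
theorem IsDLP.eq {k : E →ₗ[𝕜] E} {μ μ' : Measure σ.Gr} (h : IsDLP σ k μ) (h' : IsDLP σ k μ') :
    μ = μ' := by
  obtain ⟨hp, f, hf, hμ⟩ := h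
  obtain ⟨hp', f', hf', hμ'⟩ := h'
  have : f = f' := by
    funext Q
    exact NNReal.coe_injective (RCLike.ofReal_injective ((hf Q).trans (hf' Q).symm))
  subst this
  exact eq_of_incidence_eq (hμ.trans hμ'.symm)

end

end DLP

theorem theorem3p2 {𝕜 : Type*} [RCLike 𝕜] {E : Type*} [NormedAddCommGroup E]
    [InnerProductSpace 𝕜 E] [FiniteDimensional 𝕜 E]
    (σ : DLP.Splitting 𝕜 E) (k : E →ₗ[𝕜] E) (hk : k.IsSymmetric) (hk0 : 0 ≤ k) (hk1 : k ≤ 1) :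
    (∃! μ : Measure σ.Gr, DLP.IsDLP σ k μ) ∧
    ∃ g : σ.Gr → ℝ≥0,
      (∀ Q : σ.Gr, ((g Q : ℝ) : 𝕜) =
        LinearMap.det (k ∘ₗ (Q.1.starProjection : E →ₗ[𝕜] E) +
          (1 - k) ∘ₗ (Q.1ᗮ.starProjection : E →ₗ[𝕜] E))) ∧
      IsProbabilityMeasure (σ.nu.withDensity fun Q => (g Q : ℝ≥0∞)) ∧
      DLP.IsDLP σ k (σ.nu.withDensity fun Q => (g Q : ℝ≥0∞)) := by
  have h := DLP.isDLP_withDensity (σ := σ) hk hk0 hk1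
  exact ⟨⟨_, h, fun μ hμ => hμ.eq h⟩, DLP.processDensity σ k,
    DLP.coe_processDensity hk hk0 hk1, h.isProbabilityMeasure, h⟩
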